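/- All graphs are finite and simple. For a graph $G$, let $\Delta(G)$ be its maximum degree and let $\chi'(G)$ be its chromatic index, i.e. the least $k$ for which the edges of $G$ can be colored with $k$ colors so that no two adjacent edges receive the same color. A graph $G$ is of class 1 if $\chi'(G)=\Delta(G)$. A graph $G$ is $\Delta$-critical if $\Delta(G)=\Delta$, $\chi'(G)=\Delta+1$, and $\chi'(H)<\Delta+1$ for every proper subgraph $H$ of $G$. A graph $G$ is obtained from a graph $G_0$ by a vertex-splitting at a vertex $v$ if it arises by replacing $v$ with two new adjacent vertices $v_1$ and $v_2$ and partitioning the neighborhood $N_{G_0}(v)$ into two nonempty sets $N_1$ and $N_2$, where $v_i$ is joined to all vertices of $N_i$ for $i=1,2$ (all other adjacencies are unchanged). Theorem 1.1. Let $n$ and $\Delta$ be positive integers with $\Delta\ge \frac{3(n-1)}{4}$. If $G$ is obtained from an $(n-1)$-vertex $\Delta$-regular class 1 graph by a vertex-splitting, then $G$ is $\Delta$-critical. -/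

import Mathlib

namespace SimpleGraph

/-- The chromatic index `χ'(G)`: the least number of colors in a proper edge coloring of `G`, that
is, in a coloring of the edges in which distinct edges with a common endpoint differ in color. -/
noncomputable def chromaticIndex {V : Type*} (G : SimpleGraph V) : ℕ∞ :=
  G.lineGraph.chromaticNumber

/-- A finite graph is of class 1 if its chromatic index equals its maximum degree. -/
def IsClassOne {V : Type*} [Fintype V] (G : SimpleGraph V) [DecidableRel G.Adj] : Prop :=
  G.chromaticIndex = (G.maxDegree : ℕ∞)

/-- A finite graph `G` is `Δ`-critical if it has maximum degree `Δ` and chromatic index `Δ + 1`, and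
every proper subgraph (some vertices or edges of `G` are missing) has chromatic index less than
`Δ + 1`. -/
def IsDeltaCritical {V : Type*} [Fintype V] (G : SimpleGraph V) [DecidableRel G.Adj] (Δ : ℕ) :
    Prop :=
  G.maxDegree = Δ ∧ G.chromaticIndex = (Δ : ℕ∞) + 1 ∧
    ∀ H : G.Subgraph, H ≠ ⊤ → H.coe.chromaticIndex < (Δ : ℕ∞) + 1

/-- The graph obtained from `G` by replacing the vertex `v` with two new adjacent vertices
`Sum.inr 0` and `Sum.inr 1`, where `Sum.inr i` is joined to the old vertices that lie in `N i`. -/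
def splitAt {V : Type*} (G : SimpleGraph V) (v : V) (N : Fin 2 → Set V) :
    SimpleGraph ({u : V // u ≠ v} ⊕ Fin 2) where
  Adj
    | Sum.inl x, Sum.inl y => G.Adj x.1 y.1
    | Sum.inl x, Sum.inr i => x.1 ∈ N i
    | Sum.inr i, Sum.inl x => x.1 ∈ N i
    | Sum.inr i, Sum.inr j => i ≠ j
  symm := ⟨by
    rintro (x | i) (y | j) h
    · exact G.adj_symm h
    · exact h
    · exact h
    · exact Ne.symm h⟩
  loopless := ⟨by
    rintro (x | i) h
    · exact G.loopless.irrefl x.1 h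
    · exact h rfl⟩

/-- `G'` is (up to isomorphism) obtained from `G` by a vertex-splitting: some vertex `v` of `G` is
replaced with two new adjacent vertices, and the neighborhood of `v` is partitioned into two
nonempty sets, one of which is joined to each of the new vertices. -/
def IsVertexSplitting {V W : Type*} (G : SimpleGraph V) (G' : SimpleGraph W) : Prop :=
  ∃ (v : V) (N : Fin 2 → Set V), (N 0).Nonempty ∧ (N 1).Nonempty ∧ Disjoint (N 0) (N 1) ∧
    N 0 ∪ N 1 = G.neighborSet v ∧ Nonempty (G' ≃g G.splitAt v N)

end SimpleGraph

/-! Let `a` and `b` be the two new vertices. A Δ-edge-coloring of `G₀` consists of perfect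
matchings, so `G` has odd order, and it yields a Δ-coloring of `G - ab`. All degrees in `G` are Δ
except those of `a` and `b`, whose sum is Δ + 2. Since the order is odd, every color of a Δ-coloring
of `G` would be missing at `a` or `b`, but these miss only Δ - 2 colors together. What remains is
that `G - xy` is Δ-colorable for every edge `xy`.

Suppose it is not. Then `G - xy - ab` has Δ-colorings, but in none of them do `a` and `b` miss a
common color. Counting shows that `xy` is disjoint from `ab` and that the colors missing at `a` and
at `b` partition all colors. Alternating chains from `a` therefore end at `b`, so colors missing at
third vertices can be exchanged freely (`exists_shift`). Since `x` and `y` miss a color, a fan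
argument (`ne_of_adj`) shows that neither is adjacent to `a` or `b`. If both `a` and `b` have degree
below Δ, a Kierstead path argument (`ne_of_adj_of_adj`) also excludes distance two, whereas the
bound on Δ makes the neighborhood of `x` meet that of `a` or `b`.

Otherwise one new vertex has degree Δ and the other degree 2; say that `a` has just the neighbors
`b` and `c`. Delete `ac` too. A coloring in which `b` and `c` miss different colors suffices, since
`ab` and `ac` can take these. If `b` and `c` always miss the same color, parity forces the same on
`x` and `y`. The bound on Δ supplies a common neighbor `u` of `b`, `x`, `y`, and Kempe changes
around `u` (`exists_missing_ne_of_color_eq`) separate `b` from `c` after all. -/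

namespace SimpleGraph

/-! ### Alternating chains of two involutions -/

/-- For two involutions `f` and `g` of a finite set, the orbit of a point fixed by `f` but not by
`g` contains exactly one other point that is fixed by `f` or by `g`. -/
theorem exists_alternating_chain {W : Type*} [Finite W] {f g : W → W}
    (hf : Function.Involutive f) (hg : Function.Involutive g) {p : W} (hfp : f p = p)
    (hgp : g p ≠ p) :
    ∃ (S : Set W) (q : W), p ∈ S ∧ q ∈ S ∧ q ≠ p ∧ (f q = q ∨ g q = q) ∧
      ¬ (f q = q ∧ g q = q) ∧ (∀ z ∈ S, f z ∈ S) ∧ (∀ z ∈ S, g z ∈ S) ∧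
      ∀ z ∈ S, f z = z ∨ g z = z → z = p ∨ z = q := by
  classical
  set F : Equiv.Perm W := hf.toPerm f
  set H : Equiv.Perm W := hg.toPerm g
  -- Conjugation by `F` inverts `r`, and `F` fixes `p`. The orbit of `p` thus consists of the points
  -- `(r ^ i) p`, on which `f` acts as `i ↦ -i` and `g` as `i ↦ -i - 1`, modulo the period `N`.
  set r : Equiv.Perm W := F * H with hr
  have hF2 : F * F = 1 := by ext z; exact hf z
  have hH2 : H * H = 1 := by ext z; exact hg z
  have hFi : F⁻¹ = F := inv_eq_of_mul_eq_one_left hF2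
  have hHi : H⁻¹ = H := inv_eq_of_mul_eq_one_left hH2
  have hFr : F * r * F⁻¹ = r⁻¹ := by
    rw [hr, mul_inv_rev, hFi, hHi, ← mul_assoc, hF2, one_mul]
  have hFp : F p = p := hfp
  have hfr : ∀ i : ℤ, f ((r ^ i) p) = (r ^ (-i)) p := by
    intro i
    have h1 : F * r ^ i * F⁻¹ = r ^ (-i) := by
      rw [← conj_zpow, hFr, inv_zpow, zpow_neg]
    have h2 : (F * r ^ i * F⁻¹) p = (r ^ (-i)) p := by rw [h1]
    rw [← h2]
    simp only [hFi, Equiv.Perm.mul_apply, hFp]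
    rfl
  have hgr : ∀ i : ℤ, g ((r ^ i) p) = (r ^ (-i - 1)) p := by
    intro i
    have h1 : H = F * r := by rw [hr, ← mul_assoc, hF2, one_mul]
    have h2 : H ((r ^ i) p) = F ((r ^ (i + 1)) p) := by
      rw [h1, Equiv.Perm.mul_apply, ← Equiv.Perm.mul_apply r, ← zpow_one_add, add_comm]
    have h3 := hfr (i + 1)
    rw [show -i - 1 = -(i + 1) by ring, ← h3]
    exact h2
  set N : ℕ := Function.minimalPeriod (r • ·) p with hN
  have key : ∀ i : ℤ, (r ^ i) p = p ↔ (N : ℤ) ∣ i := fun i =>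
    MulAction.zpow_smul_eq_iff_minimalPeriod_dvd (a := r) (b := p) (n := i)
  have key2 : ∀ i j : ℤ, (r ^ i) p = (r ^ j) p ↔ (N : ℤ) ∣ i - j := by
    intro i j
    rw [← key, sub_eq_neg_add, zpow_add, zpow_neg, Equiv.Perm.mul_apply, Equiv.Perm.inv_eq_iff_eq]
  have hNpos : 0 < N := by
    have h := (isOfFinOrder_of_finite r).orderOf_pos
    have h2 : (N : ℤ) ∣ orderOf r := by
      rw [← key, zpow_natCast, pow_orderOf_eq_one]; rfl
    rcases Nat.eq_zero_or_pos N with h0 | h0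
    · rw [h0, Nat.cast_zero, zero_dvd_iff, Nat.cast_eq_zero] at h2
      exact absurd h2 h.ne'
    · exact h0
  have hN1 : N ≠ 1 := by
    intro h1
    have h2 : (r ^ (-1 : ℤ)) p = p := by rw [key, h1]; simp
    have h3 := hgr 0
    simp only [zpow_zero, Equiv.Perm.one_apply] at h3
    exact hgp (h3.trans h2)
  have hq : N % 2 = 0 ∨ N % 2 = 1 := by omega
  -- Fixed points solve `2 * i ≡ 0` or `2 * i + 1 ≡ 0` modulo `N`. Besides `i = 0` this leaves only
  -- `i = N / 2`, fixed by `f` if `N` is even and by `g` if `N` is odd; it differs from `0` because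
  -- `N ≠ 1`.
  refine ⟨{z | ∃ i : ℤ, z = (r ^ i) p}, (r ^ ((N / 2 : ℕ) : ℤ)) p, ⟨0, by simp⟩, ⟨_, rfl⟩,
    ?_, ?_, ?_, ?_, ?_, ?_⟩
  · rw [Ne, key, Int.natCast_dvd_natCast]
    intro h
    have := Nat.le_of_dvd (by omega) h
    omega
  · rw [hfr, hgr, key2, key2]
    rcases hq with h | h
    · left; exact ⟨-1, by omega⟩
    · right; exact ⟨-1, by omega⟩
  · rw [hfr, hgr, key2, key2]
    rintro ⟨h1, h2⟩
    have h3 := dvd_sub h1 h2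
    rw [show ∀ i : ℤ, -i - i - (-i - 1 - i) = ((1 : ℕ) : ℤ) by intro i; push_cast; ring,
      Int.natCast_dvd_natCast, Nat.dvd_one] at h3
    exact hN1 h3
  · rintro _ ⟨i, rfl⟩; exact ⟨_, hfr i⟩
  · rintro _ ⟨i, rfl⟩; exact ⟨_, hgr i⟩
  · rintro _ ⟨i, rfl⟩ h
    rw [hfr, hgr, key2, key2] at h
    rw [key, key2]
    rcases h with ⟨k, hk⟩ | ⟨k, hk⟩
    · rcases hq with h0 | h0
      · obtain ⟨t, ht⟩ : ∃ t : ℕ, N = 2 * t := ⟨N / 2, by omega⟩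
        have ht2 : N / 2 = t := by omega
        rw [ht2, ht]
        rw [ht] at hk
        push_cast at hk ⊢
        have hi : i = t * -k := by linarith
        rcases Int.even_or_odd' (-k) with ⟨j, hj | hj⟩
        · left; exact ⟨j, by rw [hi, hj]; ring⟩
        · right; exact ⟨j, by rw [hi, hj]; ring⟩
      · left
        have h2 : (N : ℤ) ∣ 2 * i := ⟨-k, by linarith⟩
        refine IsCoprime.dvd_of_dvd_mul_left ?_ h2
        rw [Int.isCoprime_iff_gcd_eq_one]
        simp only [Int.gcd, Int.natAbs_natCast]
        exact Nat.coprime_two_right.mpr (Nat.odd_iff.mpr h0)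
    · rcases hq with h0 | h0
      · exfalso
        have h1 : (2 : ℤ) ∣ N := by omega
        have h2 : (2 : ℤ) ∣ -i - 1 - i := h1.trans ⟨k, hk⟩
        omega
      · right
        obtain ⟨t, ht⟩ : ∃ t : ℕ, N = 2 * t + 1 := ⟨N / 2, by omega⟩
        have ht2 : N / 2 = t := by omega
        rw [ht2]
        have h2 : (N : ℤ) ∣ 2 * (i - t) := by
          refine ⟨-k - 1, ?_⟩
          rw [ht] at hk ⊢
          push_cast at hk ⊢
          linarith
        refine IsCoprime.dvd_of_dvd_mul_left ?_ h2
        rw [Int.isCoprime_iff_gcd_eq_one]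
        simp only [Int.gcd, Int.natAbs_natCast]
        exact Nat.coprime_two_right.mpr (Nat.odd_iff.mpr h0)

/-! ### Edge colorings as families of involutions, and Kempe changes -/

/-- A proper edge coloring of `A` with colors in `K`, given by its color classes: the class of `c`
is the matching that joins `p` to `m c p`, where `m c p = p` means that no edge at `p` has color
`c`. -/
structure EdgeColoring {W : Type*} (A : SimpleGraph W) (K : Type*) where
  m : K → W → W
  invol : ∀ c p, m c (m c p) = p
  adj_iff : ∀ p q, A.Adj p q ↔ p ≠ q ∧ ∃ c, m c p = q
  inj : ∀ c d p, m c p = m d p → m c p ≠ p → c = d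

namespace EdgeColoring

variable {W K : Type*} {A : SimpleGraph W}

theorem symm_eq (M : A.EdgeColoring K) {c : K} {p q : W} (h : M.m c p = q) : M.m c q = p := by
  rw [← h, M.invol]

theorem eq_iff (M : A.EdgeColoring K) {c : K} {p q : W} : M.m c p = q ↔ M.m c q = p :=
  ⟨M.symm_eq, M.symm_eq⟩

theorem injective (M : A.EdgeColoring K) (c : K) : Function.Injective (M.m c) :=
  Function.Involutive.injective (M.invol c)

theorem adj_of_eq (M : A.EdgeColoring K) {c : K} {p q : W} (h : M.m c p = q) (hne : p ≠ q) :
    A.Adj p q := (M.adj_iff p q).2 ⟨hne, c, h⟩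

theorem exists_color (M : A.EdgeColoring K) {p q : W} (h : A.Adj p q) : ∃ c, M.m c p = q :=
  ((M.adj_iff p q).1 h).2

theorem color_unique (M : A.EdgeColoring K) {c d : K} {p q : W} (hc : M.m c p = q)
    (hd : M.m d p = q) (hne : p ≠ q) : c = d :=
  M.inj c d p (hc.trans hd.symm) (by rw [hc]; exact hne.symm)

theorem map_ne_color (M : A.EdgeColoring K) {c d : K} {p q : W} (hc : M.m c p = q)
    (hd : M.m d p ≠ q) : c ≠ d := by
  rintro rfl; exact hd hc

open Classical in
/-- The interchange of the colors `k` and `l` on a set `S` that no edge of these colors leaves. -/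
noncomputable def kempe (M : A.EdgeColoring K) (k l : K) (S : Set W)
    (hk : ∀ z ∈ S, M.m k z ∈ S) (hl : ∀ z ∈ S, M.m l z ∈ S) : A.EdgeColoring K where
  m c p := if p ∈ S then M.m (Equiv.swap k l c) p else M.m c p
  invol c p := by
    have hS : ∀ d, d = k ∨ d = l → ∀ z, M.m d z ∈ S → z ∈ S := by
      rintro d (rfl | rfl) z hz
      · simpa [M.invol] using hk _ hz
      · simpa [M.invol] using hl _ hz
    by_cases hc : c = k ∨ c = l
    · have hd : Equiv.swap k l c = k ∨ Equiv.swap k l c = l := by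
        rcases hc with rfl | rfl <;> simp
      by_cases hp : p ∈ S
      · have h2 : M.m (Equiv.swap k l c) p ∈ S := by
          rcases hd with h | h <;> rw [h]
          · exact hk _ hp
          · exact hl _ hp
        simp [hp, h2, M.invol]
      · have h2 : M.m c p ∉ S := fun h => hp (hS c hc p h)
        simp [hp, h2, M.invol]
    · push Not at hc
      simp [Equiv.swap_apply_of_ne_of_ne hc.1 hc.2, M.invol]
  adj_iff p q := by
    rw [M.adj_iff]
    refine and_congr_right fun _ => ?_
    by_cases hp : p ∈ S
    · simp only [hp, if_true]
      exact ⟨fun ⟨c, hc⟩ => ⟨Equiv.swap k l c, by simpa using hc⟩, fun ⟨c, hc⟩ => ⟨_, hc⟩⟩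
    · simp only [hp, if_false]
  inj c d p h hne := by
    by_cases hp : p ∈ S
    · simp only [hp, if_true] at h hne
      exact (Equiv.swap k l).injective (M.inj _ _ p h hne)
    · simp only [hp, if_false] at h hne
      exact M.inj _ _ p h hne

section kempe

variable (M : A.EdgeColoring K) {k l : K} {S : Set W}
    (hk : ∀ z ∈ S, M.m k z ∈ S) (hl : ∀ z ∈ S, M.m l z ∈ S)

theorem kempe_of_notMem {p : W} (hp : p ∉ S) (c : K) : (M.kempe k l S hk hl).m c p = M.m c p :=
  if_neg hp

theorem kempe_left {p : W} (hp : p ∈ S) : (M.kempe k l S hk hl).m k p = M.m l p := by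
  simp [kempe, hp]

theorem kempe_right {p : W} (hp : p ∈ S) : (M.kempe k l S hk hl).m l p = M.m k p := by
  simp [kempe, hp]

theorem kempe_of_ne {c : K} (h1 : c ≠ k) (h2 : c ≠ l) (p : W) :
    (M.kempe k l S hk hl).m c p = M.m c p := by
  classical simp [kempe, Equiv.swap_apply_of_ne_of_ne h1 h2]

end kempe

/-- This allows Kempe changes everywhere off a chain, which keep the colors on the chain itself. -/
theorem compl_closed (M : A.EdgeColoring K) {k : K} {S : Set W} (hk : ∀ z ∈ S, M.m k z ∈ S) :
    ∀ z ∈ Sᶜ, M.m k z ∈ Sᶜ := by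
  intro z hz h
  exact hz (by simpa [M.invol] using hk _ h)

open Classical in
/-- The removal of the edge `uw` of color `k`. -/
noncomputable def removeEdge (M : A.EdgeColoring K) {u w : W} {k : K} (h : M.m k u = w)
    (hne : u ≠ w) (B : SimpleGraph W) (hB : ∀ p q, B.Adj p q ↔ A.Adj p q ∧ s(p, q) ≠ s(u, w)) :
    B.EdgeColoring K where
  m c p := if c = k ∧ (p = u ∨ p = w) then p else M.m c p
  invol c p := by
    have h' := M.symm_eq h
    by_cases hc : c = k ∧ (p = u ∨ p = w)
    · simp [hc]
    · have : ¬ (c = k ∧ (M.m c p = u ∨ M.m c p = w)) := by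
        rintro ⟨rfl, h1 | h1⟩
        · exact hc ⟨rfl, Or.inr ((M.symm_eq h1).symm.trans h)⟩
        · exact hc ⟨rfl, Or.inl ((M.symm_eq h1).symm.trans h')⟩
      simp only [hc, this, if_false, M.invol]
  adj_iff p q := by
    have h' := M.symm_eq h
    rw [hB, M.adj_iff]
    constructor
    · rintro ⟨⟨hpq, c, hc⟩, hs⟩
      refine ⟨hpq, c, ?_⟩
      rw [if_neg, hc]
      rintro ⟨rfl, rfl | rfl⟩
      · rw [h] at hc; exact hs (by rw [hc])
      · rw [h'] at hc; exact hs (by rw [hc, Sym2.eq_swap])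
    · rintro ⟨hpq, c, hc⟩
      split_ifs at hc with h1
      · exact absurd hc hpq
      · refine ⟨⟨hpq, c, hc⟩, ?_⟩
        intro hs
        rw [Sym2.eq_iff] at hs
        rcases hs with ⟨rfl, rfl⟩ | ⟨rfl, rfl⟩
        · exact h1 ⟨M.color_unique hc h hne, Or.inl rfl⟩
        · exact h1 ⟨M.color_unique hc h' hne.symm, Or.inr rfl⟩
  inj c d p h1 h2 := by
    split_ifs at h1 h2 with h3 h4
    · exact absurd rfl h2
    · exact absurd rfl h2
    · exact absurd h1 h2
    · exact M.inj c d p h1 h2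

section removeEdge

variable (M : A.EdgeColoring K) {u w : W} {k : K} (h : M.m k u = w) (hne : u ≠ w)
  (B : SimpleGraph W) (hB : ∀ p q, B.Adj p q ↔ A.Adj p q ∧ s(p, q) ≠ s(u, w))

theorem removeEdge_left : (M.removeEdge h hne B hB).m k u = u := by simp [removeEdge]

theorem removeEdge_right : (M.removeEdge h hne B hB).m k w = w := by simp [removeEdge]

theorem removeEdge_of_ne {c : K} (hc : c ≠ k) (p : W) :
    (M.removeEdge h hne B hB).m c p = M.m c p := by simp [removeEdge, hc]

theorem removeEdge_of_ne_of_ne {p : W} (hpu : p ≠ u) (hpw : p ≠ w) (c : K) :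
    (M.removeEdge h hne B hB).m c p = M.m c p := by simp [removeEdge, hpu, hpw]

end removeEdge

open Classical in
/-- The addition of the edge `uw`, in the color `k`, which is missing at `u` and at `w`. -/
noncomputable def addEdge (M : A.EdgeColoring K) {u w : W} {k : K} (hu : M.m k u = u)
    (hw : M.m k w = w) (hne : u ≠ w) (hA : ¬ A.Adj u w) (B : SimpleGraph W)
    (hB : ∀ p q, B.Adj p q ↔ A.Adj p q ∨ s(p, q) = s(u, w)) : B.EdgeColoring K where
  m c p := if c = k ∧ p = u then w else if c = k ∧ p = w then u else M.m c p
  invol c p := by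
    have h1 : M.m k p = u → p = u := fun h => by rw [← M.symm_eq h, hu]
    have h2 : M.m k p = w → p = w := fun h => by rw [← M.symm_eq h, hw]
    by_cases hc : c = k
    · subst hc
      by_cases hpu : p = u
      · simp [hpu, hne.symm]
      · by_cases hpw : p = w
        · simp [hpw, hne.symm]
        · have h3 : M.m c p ≠ u := fun h => hpu (h1 h)
          have h4 : M.m c p ≠ w := fun h => hpw (h2 h)
          simp [hpu, hpw, h3, h4, M.invol]
    · simp [hc, M.invol]
  adj_iff p q := by
    rw [hB]
    constructor
    · rintro (h | h)
      · obtain ⟨c, hc⟩ := M.exists_color h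
        refine ⟨h.ne, c, ?_⟩
        rw [if_neg, if_neg, hc]
        · rintro ⟨rfl, rfl⟩; exact h.ne (hw.symm.trans hc)
        · rintro ⟨rfl, rfl⟩; exact h.ne (hu.symm.trans hc)
      · rw [Sym2.eq_iff] at h
        rcases h with ⟨rfl, rfl⟩ | ⟨rfl, rfl⟩
        · exact ⟨hne, k, by simp⟩
        · exact ⟨hne.symm, k, by simp [hne.symm]⟩
    · rintro ⟨hpq, c, hc⟩
      split_ifs at hc with h1 h2
      · right; rw [h1.2, hc]
      · right; rw [h2.2, hc, Sym2.eq_swap]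
      · exact Or.inl (M.adj_of_eq hc hpq)
  inj c d p h1 h2 := by
    have hA' : ¬ A.Adj w u := fun h => hA h.symm
    have key1 : ∀ c, M.m c u ≠ w := fun c h => hA (M.adj_of_eq h hne)
    have key2 : ∀ c, M.m c w ≠ u := fun c h => hA' (M.adj_of_eq h hne.symm)
    by_cases hpu : p = u
    · subst hpu
      by_cases hc : c = k <;> by_cases hd : d = k
      · rw [hc, hd]
      · simp [hc, hd, hne] at h1; exact absurd h1.symm (key1 d)
      · simp [hc, hd, hne] at h1; exact absurd h1 (key1 c)
      · simp only [hc, hd, false_and, if_false] at h1 h2; exact M.inj _ _ _ h1 h2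
    · by_cases hpw : p = w
      · subst hpw
        by_cases hc : c = k <;> by_cases hd : d = k
        · rw [hc, hd]
        · simp [hc, hd, hpu] at h1; exact absurd h1.symm (key2 d)
        · simp [hc, hd, hpu] at h1; exact absurd h1 (key2 c)
        · simp only [hc, hd, false_and, if_false] at h1 h2; exact M.inj _ _ _ h1 h2
      · simp only [hpu, hpw, and_false, if_false] at h1 h2
        exact M.inj _ _ _ h1 h2

section addEdge

variable (M : A.EdgeColoring K) {u w : W} {k : K} (hu : M.m k u = u) (hw : M.m k w = w)
  (hne : u ≠ w) (hA : ¬ A.Adj u w) (B : SimpleGraph W)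
  (hB : ∀ p q, B.Adj p q ↔ A.Adj p q ∨ s(p, q) = s(u, w))

theorem addEdge_of_ne {c : K} (hc : c ≠ k) (p : W) :
    (M.addEdge hu hw hne hA B hB).m c p = M.m c p := by simp [addEdge, hc]

theorem addEdge_of_ne_of_ne {p : W} (hpu : p ≠ u) (hpw : p ≠ w) (c : K) :
    (M.addEdge hu hw hne hA B hB).m c p = M.m c p := by simp [addEdge, hpu, hpw]

end addEdge

/-- The number of colors missing at a vertex and the degree of the vertex sum to the number of
colors. -/
theorem ncard_missing_add [Finite W] [Finite K] (M : A.EdgeColoring K) (p : W) :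
    {c | M.m c p = p}.ncard + (A.neighborSet p).ncard = Nat.card K := by
  have h : A.neighborSet p = (fun c => M.m c p) '' {c | M.m c p = p}ᶜ := by
    ext q
    simp only [mem_neighborSet, M.adj_iff, Set.mem_image, Set.mem_compl_iff, Set.mem_ofPred_eq]
    constructor
    · rintro ⟨hne, c, hc⟩
      exact ⟨c, by rw [hc]; exact hne.symm, hc⟩
    · rintro ⟨c, h1, h2⟩
      exact ⟨by rw [← h2]; exact fun h => h1 h.symm, c, h2⟩
  rw [h, Set.InjOn.ncard_image, Set.ncard_add_ncard_compl]
  intro c hc d _ h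
  exact M.inj c d p h hc

theorem ne_of_ncard_eq [Finite W] [Finite K] (M : A.EdgeColoring K) {p : W}
    (h : (A.neighborSet p).ncard = Nat.card K) (c : K) : M.m c p ≠ p := by
  intro hc
  have h1 := M.ncard_missing_add p
  have h2 : {c | M.m c p = p}.ncard = 0 := by omega
  rw [Set.ncard_eq_zero] at h2
  have h3 : c ∈ {c | M.m c p = p} := hc
  simp [h2] at h3

theorem exists_missing [Finite W] [Finite K] (M : A.EdgeColoring K) {p : W}
    (h : (A.neighborSet p).ncard < Nat.card K) : ∃ c, M.m c p = p := by
  have h1 := M.ncard_missing_add p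
  have h2 : 0 < {c | M.m c p = p}.ncard := by omega
  rw [Set.ncard_pos] at h2
  exact h2

theorem exists_missing_ne [Finite W] [Finite K] (M : A.EdgeColoring K) {p : W}
    (h : (A.neighborSet p).ncard + 1 < Nat.card K) (d : K) : ∃ c, M.m c p = p ∧ c ≠ d := by
  have h1 := M.ncard_missing_add p
  obtain ⟨c, hc, h⟩ := Set.exists_ne_of_one_lt_ncard (s := {c | M.m c p = p}) (by omega) d
  exact ⟨c, hc, h⟩

theorem missing_unique [Finite W] [Finite K] (M : A.EdgeColoring K) {p : W}
    (h : (A.neighborSet p).ncard + 1 = Nat.card K) {c d : K} (hc : M.m c p = p)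
    (hd : M.m d p = p) : c = d := by
  have h1 := M.ncard_missing_add p
  have h2 : {c | M.m c p = p}.ncard ≤ 1 := by omega
  exact (Set.ncard_le_one_iff).1 h2 hc hd

/-- The number of vertices at which a color is missing has the parity of the number of vertices. -/
theorem ncard_fixed_modEq [Finite W] (M : A.EdgeColoring K) (c : K) :
    Nat.card W ≡ {p | M.m c p = p}.ncard [MOD 2] := by
  classical
  have := Fintype.ofFinite W
  have h := Equiv.Perm.card_fixedPoints_modEq (f := (M.m c : Function.End W)) (p := 2) (n := 1)
    (by funext p; exact M.invol c p)
  rw [Nat.card_eq_fintype_card]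
  convert h using 1
  rw [← Nat.card_eq_fintype_card]
  rfl

/-- The alternating chain of a vertex at which exactly one of two colors is missing ends at exactly
one other such vertex. -/
theorem exists_chain [Finite W] (M : A.EdgeColoring K) {k l : K} {p : W}
    (hp : M.m k p = p ∧ M.m l p ≠ p ∨ M.m k p ≠ p ∧ M.m l p = p) :
    ∃ (S : Set W) (q : W), p ∈ S ∧ q ∈ S ∧ q ≠ p ∧ (M.m k q = q ∨ M.m l q = q) ∧
      ¬ (M.m k q = q ∧ M.m l q = q) ∧ (∀ z ∈ S, M.m k z ∈ S) ∧ (∀ z ∈ S, M.m l z ∈ S) ∧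
      ∀ z ∈ S, M.m k z = z ∨ M.m l z = z → z = p ∨ z = q := by
  rcases hp with ⟨h1, h2⟩ | ⟨h1, h2⟩
  · exact exists_alternating_chain (M.invol k) (M.invol l) h1 h2
  · obtain ⟨S, q, a1, a2, a3, a4, a5, a6, a7, a8⟩ :=
      exists_alternating_chain (M.invol l) (M.invol k) h2 h1
    exact ⟨S, q, a1, a2, a3, a4.symm, fun h => a5 h.symm, a7, a6, fun z hz h => a8 z hz h.symm⟩

/-! ### Recoloring around `u` while the edge `uw` is uncolored -/

variable {W K : Type*} {A A' : SimpleGraph W} {b c x y u w : W} {k₀ B X Y : K}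

/-- Rotation of the colors at `u`, with `uw` uncolored, when the alternating chain of `w` avoids
`u` and `x`. -/
theorem missing_ne_of_chain_avoids (R : A'.EdgeColoring K) (hbc : b ≠ c) (hbx : b ≠ x)
    (hub : u ≠ b) (huc : u ≠ c) (hux : u ≠ x) (huw : u ≠ w) (hwb : w ≠ b) (hwc : w ≠ c)
    (hA' : ¬ A'.Adj u w) (hA : ∀ p q, A.Adj p q ↔ A'.Adj p q ∨ s(p, q) = s(u, w))
    (Rb : R.m X b = b) (Rc : R.m X c = c) (Ru : R.m k₀ u = u) (Rw : R.m k₀ w = w)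
    (Rx : R.m k₀ x = x) (Rux : R.m X u = x) (Rub : R.m B u = b)
    {D : Set W} (D0 : ∀ z ∈ D, R.m k₀ z ∈ D) (DB : ∀ z ∈ D, R.m B z ∈ D) (wD : w ∈ D)
    (uD : u ∉ D) (xD : x ∉ D) :
    ∃ (M : A.EdgeColoring K) (k l : K), k ≠ l ∧ M.m k b = b ∧ M.m l c = c := by
  have c0X : k₀ ≠ X := R.map_ne_color Ru (by rw [Rux]; exact hux.symm)
  have c0B : k₀ ≠ B := R.map_ne_color Ru (by rw [Rub]; exact hub.symm)
  have cBX : B ≠ X := R.map_ne_color Rub (by rw [Rux]; exact hbx.symm)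
  let R1 := R.kempe k₀ B D D0 DB
  have R1u : R1.m k₀ u = u := by rw [R.kempe_of_notMem D0 DB uD, Ru]
  have R1x : R1.m k₀ x = x := by rw [R.kempe_of_notMem D0 DB xD, Rx]
  have R1w : R1.m B w = w := by rw [R.kempe_right D0 DB wD, Rw]
  have R1X : ∀ z, R1.m X z = R.m X z := R.kempe_of_ne D0 DB c0X.symm cBX.symm
  have R1ub : R1.m B u = b := by rw [R.kempe_of_notMem D0 DB uD, Rub]
  have R1ux : R1.m X u = x := by rw [R1X, Rux]
  -- Both `u` and `x` miss `k₀`, so the edge `ux` alone is a chain; its recoloring frees `X` at `u`.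
  have P0 : ∀ z ∈ ({u, x} : Set W), R1.m k₀ z ∈ ({u, x} : Set W) := by
    rintro z (rfl | rfl)
    · rw [R1u]; simp
    · rw [R1x]; simp
  have PX : ∀ z ∈ ({u, x} : Set W), R1.m X z ∈ ({u, x} : Set W) := by
    rintro z (rfl | rfl)
    · rw [R1ux]; simp
    · rw [R1.symm_eq R1ux]; simp
  let R2 := R1.kempe k₀ X {u, x} P0 PX
  have R2u : R2.m X u = u := by rw [R1.kempe_right P0 PX (by simp), R1u]
  have R2b : R2.m X b = b := by
    rw [R1.kempe_of_notMem P0 PX (by simp [hub.symm, hbx]), R1X, Rb]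
  have R2c : R2.m X c = c := by
    have hxc : x ≠ c := by
      rintro rfl; exact hux ((R.symm_eq Rux).symm.trans Rc)
    rw [R1.kempe_of_notMem P0 PX (by simp [huc.symm, hxc.symm]), R1X, Rc]
  have R2B : ∀ z, R2.m B z = R1.m B z := R1.kempe_of_ne P0 PX c0B.symm cBX
  -- Now `u` and `b` both miss `X`, so `ub` can pass from `B` to `X`. This frees `B` at `u` for the
  -- edge `uw`, since `w` has missed `B` from the first exchange on.
  have QB : ∀ z ∈ ({u, b} : Set W), R2.m B z ∈ ({u, b} : Set W) := by
    rintro z (rfl | rfl)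
    · rw [R2B, R1ub]; simp
    · rw [R2B, R1.symm_eq R1ub]; simp
  have QX : ∀ z ∈ ({u, b} : Set W), R2.m X z ∈ ({u, b} : Set W) := by
    rintro z (rfl | rfl)
    · rw [R2u]; simp
    · rw [R2b]; simp
  let R3 := R2.kempe B X {u, b} QB QX
  have R3b : R3.m B b = b := by rw [R2.kempe_left QB QX (by simp), R2b]
  have R3u : R3.m B u = u := by rw [R2.kempe_left QB QX (by simp), R2u]
  have R3w : R3.m B w = w := by
    rw [R2.kempe_of_notMem QB QX (by simp [huw.symm, hwb]), R2B, R1w]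
  have R3c : R3.m X c = c := by
    rw [R2.kempe_of_notMem QB QX (by simp [huc.symm, hbc.symm]), R2c]
  exact ⟨R3.addEdge R3u R3w huw hA' A hA, B, X, cBX,
    by rw [addEdge_of_ne_of_ne _ _ _ _ _ _ _ hub.symm hwb.symm, R3b],
    by rw [addEdge_of_ne_of_ne _ _ _ _ _ _ _ huc.symm hwc.symm, R3c]⟩

/-- Rotation of the colors at `u`, with `uw` uncolored, when the alternating chain of `w` ends at
`u`. -/
theorem missing_ne_of_chain_ends (R : A'.EdgeColoring K) (hbc : b ≠ c) (hbx : b ≠ x)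
    (hub : u ≠ b) (huc : u ≠ c) (hux : u ≠ x) (huw : u ≠ w) (hwb : w ≠ b) (hwc : w ≠ c)
    (hA' : ¬ A'.Adj u w) (hA : ∀ p q, A.Adj p q ↔ A'.Adj p q ∨ s(p, q) = s(u, w))
    (Rb : R.m X b = b) (Rc : R.m X c = c) (Ru : R.m k₀ u = u) (Rw : R.m k₀ w = w)
    (Rx : R.m k₀ x = x) (Rux : R.m X u = x) (Rub : R.m B u = b)
    {D : Set W} (D0 : ∀ z ∈ D, R.m k₀ z ∈ D) (DB : ∀ z ∈ D, R.m B z ∈ D) (wD : w ∈ D)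
    (uD : u ∈ D) (xD : x ∉ D) :
    ∃ (M : A.EdgeColoring K) (k l : K), k ≠ l ∧ M.m k b = b ∧ M.m l c = c := by
  have c0X : k₀ ≠ X := R.map_ne_color Ru (by rw [Rux]; exact hux.symm)
  have c0B : k₀ ≠ B := R.map_ne_color Ru (by rw [Rub]; exact hub.symm)
  have cBX : B ≠ X := R.map_ne_color Rub (by rw [Rux]; exact hbx.symm)
  have hxc : x ≠ c := by
    rintro rfl; exact hux ((R.symm_eq Rux).symm.trans Rc)
  -- The exchange off `D` makes `x` miss `B` and leaves `k₀` missing at `u` and `w`, ready for the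
  -- edge `uw`.
  have E0 := R.compl_closed D0
  have EB := R.compl_closed DB
  let R1 := R.kempe k₀ B Dᶜ E0 EB
  have uE : u ∉ Dᶜ := fun h => h uD
  have wE : w ∉ Dᶜ := fun h => h wD
  have R1u : R1.m k₀ u = u := by rw [R.kempe_of_notMem E0 EB uE, Ru]
  have R1x : R1.m B x = x := by rw [R.kempe_right E0 EB xD, Rx]
  have R1w : R1.m k₀ w = w := by rw [R.kempe_of_notMem E0 EB wE, Rw]
  have R1X : ∀ z, R1.m X z = R.m X z := R.kempe_of_ne E0 EB c0X.symm cBX.symm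
  have R1ub : R1.m B u = b := by rw [R.kempe_of_notMem E0 EB uE, Rub]
  have R1ux : R1.m X u = x := by rw [R1X, Rux]
  -- The path `x`, `u`, `b` is now an entire `X`-`B` chain, as `x` misses `B` and `b` misses `X`.
  have PB : ∀ z ∈ ({x, u, b} : Set W), R1.m B z ∈ ({x, u, b} : Set W) := by
    rintro z (rfl | rfl | rfl)
    · rw [R1x]; simp
    · rw [R1ub]; simp
    · rw [R1.symm_eq R1ub]; simp
  have PX : ∀ z ∈ ({x, u, b} : Set W), R1.m X z ∈ ({x, u, b} : Set W) := by
    rintro z (rfl | rfl | rfl)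
    · rw [R1.symm_eq R1ux]; simp
    · rw [R1ux]; simp
    · rw [R1X, Rb]; simp
  let R2 := R1.kempe B X {x, u, b} PB PX
  have R20 : ∀ z, R2.m k₀ z = R1.m k₀ z := R1.kempe_of_ne PB PX c0B c0X
  have R2b : R2.m B b = b := by rw [R1.kempe_left PB PX (by simp), R1X, Rb]
  have R2c : R2.m X c = c := by
    rw [R1.kempe_of_notMem PB PX (by simp [huc.symm, hbc.symm, hxc.symm]), R1X, Rc]
  exact ⟨R2.addEdge ((R20 u).trans R1u) ((R20 w).trans R1w) huw hA' A hA, B, X, cBX,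
    by rw [addEdge_of_ne_of_ne _ _ _ _ _ _ _ hub.symm hwb.symm, R2b],
    by rw [addEdge_of_ne_of_ne _ _ _ _ _ _ _ huc.symm hwc.symm, R2c]⟩

/-- The case in which `ux` has the color missing at `w`, and an alternating chain joins `b` to
`x`. -/
theorem missing_ne_of_chain_separates [Finite W] (T : A'.EdgeColoring K)
    (hbx : b ≠ x) (hby : b ≠ y) (hcy : c ≠ y) (hxy : x ≠ y)
    (hub : u ≠ b) (huc : u ≠ c) (hux : u ≠ x) (huy : u ≠ y) (huw : u ≠ w) (hwb : w ≠ b)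
    (hwc : w ≠ c) (hwx : w ≠ x) (hwy : w ≠ y)
    (hA' : ¬ A'.Adj u w) (hA : ∀ p q, A.Adj p q ↔ A'.Adj p q ∨ s(p, q) = s(u, w))
    (huniq : ∀ (R : A'.EdgeColoring K) (k l : K), R.m k w = w → R.m l w = w → k = l)
    (Tb : T.m X b = b) (Tx : T.m X x = x) (Tu : T.m X u = u) (Tc : T.m X c = c)
    (Tw : T.m k₀ w = w) (Ty : T.m k₀ y = y) (Tux : T.m k₀ u = x) (Tuy : T.m Y u = y)
    {S : Set W} (SX : ∀ z ∈ S, T.m X z ∈ S) (SY : ∀ z ∈ S, T.m Y z ∈ S) (bS : b ∈ S)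
    (xS : x ∈ S) (uS : u ∉ S) (cS : c ∉ S) :
    ∃ (M : A.EdgeColoring K) (k l : K), k ≠ l ∧ M.m k b = b ∧ M.m l c = c := by
  have c0X : k₀ ≠ X := T.map_ne_color Tux (by rw [Tu]; exact hux)
  have c0Y : k₀ ≠ Y := T.map_ne_color Tux (by rw [Tuy]; exact hxy.symm)
  have cYX : Y ≠ X := T.map_ne_color Tuy (by rw [Tu]; exact huy)
  let T1 := T.kempe X Y S SX SY
  have T1b : T1.m Y b = b := by rw [T.kempe_right SX SY bS, Tb]
  have T1x : T1.m Y x = x := by rw [T.kempe_right SX SY xS, Tx]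
  have T1u : T1.m X u = u := by rw [T.kempe_of_notMem SX SY uS, Tu]
  have T1c : T1.m X c = c := by rw [T.kempe_of_notMem SX SY cS, Tc]
  have T10 : ∀ z, T1.m k₀ z = T.m k₀ z := T.kempe_of_ne SX SY c0X c0Y
  have T1w : T1.m k₀ w = w := by rw [T10, Tw]
  have T1y : T1.m k₀ y = y := by rw [T10, Ty]
  have T1ux : T1.m k₀ u = x := by rw [T10, Tux]
  have T1uy : T1.m Y u = y := by rw [T.kempe_of_notMem SX SY uS, Tuy]
  obtain ⟨E, q, wE, -, -, -, -, E0, EX, Eend⟩ := T1.exists_chain (k := k₀) (l := X) (p := w)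
    (Or.inl ⟨T1w, fun h => c0X (huniq T1 _ _ T1w h)⟩)
  by_cases uE : u ∈ E
  · have hqu : u = q := (Eend u uE (Or.inr T1u)).resolve_left huw
    have cE : c ∉ E := fun h => by
      rcases Eend c h (Or.inr T1c) with h1 | h1
      · exact hwc h1.symm
      · exact huc (hqu.trans h1.symm)
    have yE : y ∉ E := fun h => by
      rcases Eend y h (Or.inl T1y) with h1 | h1
      · exact hwy h1.symm
      · exact huy (hqu.trans h1.symm)
    -- The chain `E` reaches `u` through the edge `ux` of color `k₀`. An exchange on the `k₀`-`Y`
    -- chain `x`, `u`, `y` gives `ux` the color `Y` and so cuts `u` off; the exchange on `E \ {u}`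
    -- then frees `X` at `w` without disturbing `u`.
    have P0 : ∀ z ∈ ({x, u, y} : Set W), T1.m k₀ z ∈ ({x, u, y} : Set W) := by
      rintro z (rfl | rfl | rfl)
      · rw [T1.symm_eq T1ux]; simp
      · rw [T1ux]; simp
      · rw [T1y]; simp
    have PY : ∀ z ∈ ({x, u, y} : Set W), T1.m Y z ∈ ({x, u, y} : Set W) := by
      rintro z (rfl | rfl | rfl)
      · rw [T1x]; simp
      · rw [T1uy]; simp
      · rw [T1.symm_eq T1uy]; simp
    let T2 := T1.kempe k₀ Y {x, u, y} P0 PY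
    have T2x : T2.m k₀ x = x := by rw [T1.kempe_left P0 PY (by simp), T1x]
    have T2X : ∀ z, T2.m X z = T1.m X z := T1.kempe_of_ne P0 PY c0X.symm cYX.symm
    have T2n : ∀ z, z ∉ ({x, u, y} : Set W) → ∀ d, T2.m d z = T1.m d z := fun z hz =>
      T1.kempe_of_notMem P0 PY hz
    have T2w : T2.m k₀ w = w := by rw [T2n w (by simp [hwx, huw.symm, hwy]), T1w]
    have T2b : T2.m Y b = b := by rw [T2n b (by simp [hbx, hub.symm, hby]), T1b]
    have F0 : ∀ z ∈ E \ {u}, T2.m k₀ z ∈ E \ {u} := by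
      rintro z ⟨hz, hzu⟩
      by_cases hzx : z = x
      · subst hzx; rw [T2x]; exact ⟨hz, hzu⟩
      · have hzy : z ≠ y := by rintro rfl; exact yE hz
        rw [T2n z (by simp [hzx, hzy]; exact hzu)]
        exact ⟨E0 z hz, fun h => hzx ((T1.symm_eq h).symm.trans T1ux)⟩
    have FX : ∀ z ∈ E \ {u}, T2.m X z ∈ E \ {u} := by
      rintro z ⟨hz, hzu⟩
      rw [T2X]
      exact ⟨EX z hz, fun h => hzu ((T1.symm_eq h).symm.trans T1u)⟩
    let T3 := T2.kempe k₀ X (E \ {u}) F0 FX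
    have T3w : T3.m X w = w := by
      rw [T2.kempe_right F0 FX ⟨wE, huw.symm⟩, T2w]
    have T3u : T3.m X u = u := by
      rw [T2.kempe_of_notMem F0 FX (fun h => h.2 rfl), T2X, T1u]
    have T3c : T3.m X c = c := by
      rw [T2.kempe_of_notMem F0 FX (fun h => cE h.1), T2X, T1c]
    have T3b : T3.m Y b = b := by rw [T2.kempe_of_ne F0 FX c0Y.symm cYX, T2b]
    exact ⟨T3.addEdge T3u T3w huw hA' A hA, Y, X, cYX,
      by rw [addEdge_of_ne_of_ne _ _ _ _ _ _ _ hub.symm hwb.symm, T3b],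
      by rw [addEdge_of_ne_of_ne _ _ _ _ _ _ _ huc.symm hwc.symm, T3c]⟩
  · let T2 := T1.kempe k₀ X E E0 EX
    have T2w : T2.m X w = w := by rw [T1.kempe_right E0 EX wE, T1w]
    have T2u : T2.m X u = u := by rw [T1.kempe_of_notMem E0 EX uE, T1u]
    have T2b : T2.m Y b = b := by rw [T1.kempe_of_ne E0 EX c0Y.symm cYX, T1b]
    -- Wherever `c` lies, it misses `k₀` or `X`, hence a color other than the color `Y` missing at
    -- `b`.
    obtain ⟨l, hl, T2c⟩ : ∃ l, Y ≠ l ∧ T2.m l c = c := by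
      by_cases cE : c ∈ E
      · exact ⟨k₀, c0Y.symm, by rw [T1.kempe_left E0 EX cE, T1c]⟩
      · exact ⟨X, cYX, by rw [T1.kempe_of_notMem E0 EX cE, T1c]⟩
    exact ⟨T2.addEdge T2u T2w huw hA' A hA, Y, l, hl,
      by rw [addEdge_of_ne_of_ne _ _ _ _ _ _ _ hub.symm hwb.symm, T2b],
      by rw [addEdge_of_ne_of_ne _ _ _ _ _ _ _ huc.symm hwc.symm, T2c]⟩

end EdgeColoring

/-! ### Degrees after the deletion of an edge -/

theorem neighborSet_deleteEdges_of_ne {W : Type*} (A : SimpleGraph W) {p q z : W} (hp : z ≠ p)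
    (hq : z ≠ q) : (A.deleteEdges {s(p, q)}).neighborSet z = A.neighborSet z := by
  ext t
  simp only [mem_neighborSet, deleteEdges_adj, Set.mem_singleton_iff, Sym2.eq_iff]
  tauto

theorem ncard_neighborSet_deleteEdges_left {W : Type*} [Finite W] (A : SimpleGraph W) {p q : W}
    (h : A.Adj p q) :
    ((A.deleteEdges {s(p, q)}).neighborSet p).ncard + 1 = (A.neighborSet p).ncard := by
  have h1 : (A.deleteEdges {s(p, q)}).neighborSet p = A.neighborSet p \ {q} := by
    ext t
    simp only [mem_neighborSet, deleteEdges_adj, Set.mem_singleton_iff, Sym2.eq_iff, Set.mem_sdiff]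
    refine and_congr_right fun ht => not_congr ⟨?_, fun h => Or.inl ⟨trivial, h⟩⟩
    rintro (⟨-, h1⟩ | ⟨h1, -⟩)
    · exact h1
    · exact absurd h1 h.ne
  rw [h1]
  exact Set.ncard_sdiff_singleton_add_one h

theorem ncard_neighborSet_deleteEdges_right {W : Type*} [Finite W] (A : SimpleGraph W) {p q : W}
    (h : A.Adj p q) :
    ((A.deleteEdges {s(p, q)}).neighborSet q).ncard + 1 = (A.neighborSet q).ncard := by
  rw [Sym2.eq_swap]
  exact ncard_neighborSet_deleteEdges_left A h.symm

/-! ### Separating the colors missing at `b` and `c` -/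

namespace EdgeColoring

variable {W K : Type*} [Finite W] [Finite K] {A : SimpleGraph W} {b c x y u : W}

/-- If `b` and `c` miss one color, `x` and `y` miss another one, and the former is the color of an
edge that joins `x` to a common neighbor `u` of `b`, `x` and `y`, then there is a coloring in which
the colors missing at `b` and at `c` are different. -/
theorem exists_missing_ne_of_color_eq (M : A.EdgeColoring K) (hbc : b ≠ c) (hbx : b ≠ x)
    (hby : b ≠ y) (hcx : c ≠ x) (hcy : c ≠ y) (hxy : x ≠ y) (hub : u ≠ b) (huc : u ≠ c)
    (hux : u ≠ x) (huy : u ≠ y)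
    (hb : (A.neighborSet b).ncard + 1 = Nat.card K)
    (hx : (A.neighborSet x).ncard + 1 = Nat.card K) (hy : (A.neighborSet y).ncard + 1 = Nat.card K)
    (hfull : ∀ z, z ≠ b → z ≠ c → z ≠ x → z ≠ y →
      A.neighborSet z = ∅ ∨ (A.neighborSet z).ncard = Nat.card K)
    (aub : A.Adj u b) (auy : A.Adj u y) {k₀ X : K} (hwb : M.m k₀ u ≠ b)
    (hwc : M.m k₀ u ≠ c) (Mb : M.m X b = b) (Mc : M.m X c = c) (Mx : M.m k₀ x = x)
    (My : M.m k₀ y = y) (Mux : M.m X u = x) :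
    ∃ (M : A.EdgeColoring K) (k l : K), k ≠ l ∧ M.m k b = b ∧ M.m l c = c := by
  obtain ⟨B, Mub⟩ := M.exists_color aub
  obtain ⟨Y, Muy⟩ := M.exists_color auy
  have full_of_adj : ∀ z t, z ≠ b → z ≠ c → z ≠ x → z ≠ y → A.Adj z t →
      (A.neighborSet z).ncard = Nat.card K := by
    intro z t h1 h2 h3 h4 h
    refine (hfull z h1 h2 h3 h4).resolve_left fun h5 => ?_
    have : t ∈ A.neighborSet z := h
    simp [h5] at this
  have hu := full_of_adj u b hub huc hux huy aub
  obtain ⟨w, Muw⟩ : ∃ w, M.m k₀ u = w := ⟨_, rfl⟩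
  rw [Muw] at hwb hwc
  have huw : u ≠ w := by
    rintro rfl; exact M.ne_of_ncard_eq hu k₀ Muw
  have hwx : w ≠ x := by
    rintro rfl; exact huw ((M.symm_eq Muw).symm.trans Mx)
  have hwy : w ≠ y := by
    rintro rfl; exact huw ((M.symm_eq Muw).symm.trans My)
  have auw : A.Adj u w := M.adj_of_eq Muw huw
  have hw := full_of_adj w u hwb hwc hwx hwy auw.symm
  have c0X : k₀ ≠ X := M.map_ne_color Muw (by rw [Mux]; exact hwx.symm)
  have c0Y : k₀ ≠ Y := M.map_ne_color Muw (by rw [Muy]; exact hwy.symm)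
  have c0B : k₀ ≠ B := M.map_ne_color Muw (by rw [Mub]; exact hwb.symm)
  have cBX : B ≠ X := M.map_ne_color Mub (by rw [Mux]; exact hbx.symm)
  have cBY : B ≠ Y := M.map_ne_color Mub (by rw [Muy]; exact hby.symm)
  have cXY : X ≠ Y := M.map_ne_color Mux (by rw [Muy]; exact hxy.symm)
  let A' := A.deleteEdges {s(u, w)}
  have hA1 : ∀ p q, A'.Adj p q ↔ A.Adj p q ∧ s(p, q) ≠ s(u, w) := by
    intro p q
    simp only [A', deleteEdges_adj, Set.mem_singleton_iff, ne_eq]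
  have hA : ∀ p q, A.Adj p q ↔ A'.Adj p q ∨ s(p, q) = s(u, w) := by
    intro p q
    rw [hA1]
    constructor
    · intro h
      by_cases hs : s(p, q) = s(u, w)
      · exact Or.inr hs
      · exact Or.inl ⟨h, hs⟩
    · rintro (h | h)
      · exact h.1
      · rwa [← mem_edgeSet, h, mem_edgeSet]
  have hA' : ¬ A'.Adj u w := fun h => ((hA1 _ _).1 h).2 rfl
  have hu' : (A'.neighborSet u).ncard + 1 = Nat.card K := by
    rw [ncard_neighborSet_deleteEdges_left A auw, hu]
  have hw' : (A'.neighborSet w).ncard + 1 = Nat.card K := by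
    rw [ncard_neighborSet_deleteEdges_right A auw, hw]
  have hsame : ∀ z, z ≠ u → z ≠ w → A'.neighborSet z = A.neighborSet z := fun z =>
    A.neighborSet_deleteEdges_of_ne
  have hb' := hb
  rw [← hsame b hub.symm hwb.symm] at hb'
  have hx' := hx
  rw [← hsame x hux.symm hwx.symm] at hx'
  have hy' := hy
  rw [← hsame y huy.symm hwy.symm] at hy'
  have hend : ∀ (R : A'.EdgeColoring K) (k l : K) (z : W), (R.m k z = z ∨ R.m l z = z) →
      ¬ (R.m k z = z ∧ R.m l z = z) → z = b ∨ z = c ∨ z = x ∨ z = y ∨ z = u ∨ z = w := by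
    intro R k l z h1 h2
    by_contra! h
    obtain ⟨z1, z2, z3, z4, z5, z6⟩ := h
    rcases hfull z z1 z2 z3 z4 with h0 | h0
    · rw [← hsame z z5 z6] at h0
      have h3 : ∀ k, R.m k z = z := by
        intro k
        by_contra hk
        have : R.m k z ∈ A'.neighborSet z := R.adj_of_eq rfl (Ne.symm hk)
        simp [h0] at this
      exact h2 ⟨h3 k, h3 l⟩
    · rw [← hsame z z5 z6] at h0
      rcases h1 with h1 | h1
      · exact R.ne_of_ncard_eq h0 k h1
      · exact R.ne_of_ncard_eq h0 l h1
  -- With `uw` uncolored, `b` and `c` miss `X`, while `x`, `y`, `u` and `w` miss `k₀`.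
  let R := M.removeEdge Muw huw A' hA1
  have Rne : ∀ {d : K}, d ≠ k₀ → ∀ z, R.m d z = M.m d z := M.removeEdge_of_ne Muw huw A' hA1
  have Rb : R.m X b = b := by rw [Rne c0X.symm, Mb]
  have Rc : R.m X c = c := by rw [Rne c0X.symm, Mc]
  have Ru : R.m k₀ u = u := M.removeEdge_left Muw huw A' hA1
  have Rw : R.m k₀ w = w := M.removeEdge_right Muw huw A' hA1
  have Rx : R.m k₀ x = x := by
    rw [M.removeEdge_of_ne_of_ne Muw huw A' hA1 hux.symm hwx.symm, Mx]
  have Ry : R.m k₀ y = y := by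
    rw [M.removeEdge_of_ne_of_ne Muw huw A' hA1 huy.symm hwy.symm, My]
  have Rux : R.m X u = x := by rw [Rne c0X.symm, Mux]
  have Rub : R.m B u = b := by rw [Rne c0B.symm, Mub]
  have Ruy : R.m Y u = y := by rw [Rne c0Y.symm, Muy]
  obtain ⟨D, q, wD, -, -, -, -, D0, DB, Dend⟩ := R.exists_chain (k := k₀) (l := B) (p := w)
    (Or.inl ⟨Rw, fun h => c0B (R.missing_unique hw' Rw h)⟩)
  by_cases xD : x ∈ D
  swap
  · by_cases uD : u ∈ D
    · exact R.missing_ne_of_chain_ends hbc hbx hub huc hux huw hwb hwc hA' hA Rb Rc Ru Rw Rx Rux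
        Rub D0 DB wD uD xD
    · exact R.missing_ne_of_chain_avoids hbc hbx hub huc hux huw hwb hwc hA' hA Rb Rc Ru Rw Rx Rux
        Rub D0 DB wD uD xD
  have hxq : x = q := (Dend x xD (Or.inl Rx)).resolve_left hwx.symm
  have uD : u ∉ D := fun h => by
    rcases Dend u h (Or.inl Ru) with h1 | h1
    · exact huw h1
    · exact hux (h1.trans hxq.symm)
  have yD : y ∉ D := fun h => by
    rcases Dend y h (Or.inl Ry) with h1 | h1
    · exact hwy h1.symm
    · exact hxy (hxq.trans h1.symm)
  -- The chain `D` now joins `w` to `x` and avoids `u` and `y`. Once `ux` is recolored with `k₀`,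
  -- all of `b`, `c`, `u`, `x` miss `X`, and the `X`-`Y` chain of `b` must end at `c`, `x` or `u`.
  have P0 : ∀ z ∈ ({u, x} : Set W), R.m k₀ z ∈ ({u, x} : Set W) := by
    rintro z (rfl | rfl)
    · rw [Ru]; simp
    · rw [Rx]; simp
  have PX : ∀ z ∈ ({u, x} : Set W), R.m X z ∈ ({u, x} : Set W) := by
    rintro z (rfl | rfl)
    · rw [Rux]; simp
    · rw [R.symm_eq Rux]; simp
  let T := R.kempe k₀ X {u, x} P0 PX
  have Tn : ∀ z, z ∉ ({u, x} : Set W) → ∀ d, T.m d z = R.m d z := fun z hz =>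
    R.kempe_of_notMem P0 PX hz
  have Tu : T.m X u = u := by rw [R.kempe_right P0 PX (by simp), Ru]
  have Tx : T.m X x = x := by rw [R.kempe_right P0 PX (by simp), Rx]
  have Tb : T.m X b = b := by rw [Tn b (by simp [hub.symm, hbx]), Rb]
  have Tc : T.m X c = c := by rw [Tn c (by simp [huc.symm, hcx]), Rc]
  have Tw : T.m k₀ w = w := by rw [Tn w (by simp [huw.symm, hwx]), Rw]
  have Ty : T.m k₀ y = y := by rw [Tn y (by simp [huy.symm, hxy.symm]), Ry]
  have Tux : T.m k₀ u = x := by rw [R.kempe_left P0 PX (by simp), Rux]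
  have TY : ∀ z, T.m Y z = R.m Y z := R.kempe_of_ne P0 PX c0Y.symm cXY.symm
  have Tuy : T.m Y u = y := by rw [TY, Ruy]
  have huniq : ∀ (R : A'.EdgeColoring K) (k l : K), R.m k w = w → R.m l w = w → k = l :=
    fun R k l => R.missing_unique hw'
  obtain ⟨S, q', bS, qS, hqb, hq1, hq2, SX, SY, Send⟩ :=
    T.exists_chain (k := X) (l := Y) (p := b)
      (Or.inl ⟨Tb, fun h => cXY (T.missing_unique hb' Tb h)⟩)
  have hmiss : ∀ z, (A'.neighborSet z).ncard + 1 = Nat.card K → T.m k₀ z = z → q' ≠ z := by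
    rintro z hz h0 rfl
    rcases hq1 with h | h
    · exact c0X (T.missing_unique hz h0 h)
    · exact c0Y (T.missing_unique hz h0 h)
  rcases hend T X Y q' hq1 hq2 with h | h | h | h | h | h
  · exact absurd h hqb
  · have notMem : ∀ z, z ≠ b → z ≠ c → T.m X z = z → z ∉ S := fun z h1 h2 h3 h4 =>
      (Send z h4 (Or.inl h3)).elim h1 (fun h5 => h2 (h5.trans h))
    have uS : u ∉ S := notMem u hub huc Tu
    have xS : x ∉ S := notMem x hbx.symm hcx.symm Tx
    have cS : c ∈ S := h ▸ qS
    -- The chain joins `b` to `c`. It is still closed in `R`, which differs from `T` only at `u` and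
    -- `x`, both off `S`. An exchange off `S` gives `uy` the color `X` and does not touch `D`, so
    -- `y` can take the role of `x`.
    have CX : ∀ z ∈ Sᶜ, R.m X z ∈ Sᶜ := by
      intro z hz
      by_cases hzu : z = u
      · rw [hzu, Rux]; exact xS
      · by_cases hzx : z = x
        · rw [hzx, R.symm_eq Rux]; exact uS
        · rw [← Tn z (by simp [hzu, hzx])]
          exact T.compl_closed SX z hz
    have CY : ∀ z ∈ Sᶜ, R.m Y z ∈ Sᶜ := by
      intro z hz
      rw [← TY]
      exact T.compl_closed SY z hz
    let R2 := R.kempe X Y Sᶜ CX CY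
    have R2n : ∀ z ∈ S, ∀ d, R2.m d z = R.m d z := fun z hz =>
      R.kempe_of_notMem CX CY (fun h => h hz)
    have R20 : ∀ z, R2.m k₀ z = R.m k₀ z := R.kempe_of_ne CX CY c0X c0Y
    have R2B : ∀ z, R2.m B z = R.m B z := R.kempe_of_ne CX CY cBX cBY
    exact R2.missing_ne_of_chain_avoids (x := y) hbc hby hub huc huy huw hwb hwc hA' hA
      ((R2n b bS X).trans Rb) ((R2n c cS X).trans Rc) ((R20 u).trans Ru) ((R20 w).trans Rw)
      ((R20 y).trans Ry) ((R.kempe_left CX CY uS).trans Ruy) ((R2B u).trans Rub)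
      (fun z hz => by rw [R20]; exact D0 z hz) (fun z hz => by rw [R2B]; exact DB z hz) wD uD yD
  · have notMem : ∀ z, z ≠ b → z ≠ x → T.m X z = z → z ∉ S := fun z h1 h2 h3 h4 =>
      (Send z h4 (Or.inl h3)).elim h1 (fun h5 => h2 (h5.trans h))
    exact T.missing_ne_of_chain_separates hbx hby hcy hxy hub huc hux huy huw hwb hwc hwx hwy hA'
      hA huniq Tb Tx Tu Tc Tw Ty Tux Tuy SX SY bS (h ▸ qS) (notMem u hub hux Tu)
      (notMem c hbc.symm hcx Tc)
  · exact absurd h (hmiss y hy' Ty)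
  · have notMem : ∀ z, z ≠ b → z ≠ u → T.m X z = z → z ∉ S := fun z h1 h2 h3 h4 =>
      (Send z h4 (Or.inl h3)).elim h1 (fun h5 => h2 (h5.trans h))
    -- The chain joins `b` to `u`, so its complement holds `c` and `x` but neither `u` nor `b`: the
    -- roles of `b` and `c` are swapped.
    obtain ⟨M', k, l, hkl, h1, h2⟩ := T.missing_ne_of_chain_separates (b := c) (c := b) hcx hcy hby
      hxy huc hub hux huy huw hwc hwb hwx hwy hA' hA huniq Tc Tx Tu Tb Tw Ty Tux Tuy
      (T.compl_closed SX) (T.compl_closed SY) (notMem c hbc.symm huc.symm Tc)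
      (notMem x hbx.symm hux.symm Tx) (fun h' => h' (h ▸ qS)) (fun h' => h' bS)
    exact ⟨M', l, k, hkl.symm, h2, h1⟩
  · exact absurd h (hmiss w hw' Tw)

/-- Let all vertices of `A` have as many neighbors as there are colors, except for an isolated
vertex `a` and for four vertices `b`, `c`, `x`, `y` with one neighbor less. If `b`, `x` and `y` have
a common neighbor other than `c`, then in some coloring the colors missing at `b` and at `c` are
different. -/
theorem exists_missing_ne_of_common_neighbor {a : W} (hW : Odd (Nat.card W))
    (M : A.EdgeColoring K) (hab : a ≠ b) (hac : a ≠ c) (hax : a ≠ x) (hay : a ≠ y)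
    (hbc : b ≠ c) (hbx : b ≠ x)
    (hby : b ≠ y) (hcx : c ≠ x) (hcy : c ≠ y) (hxy : x ≠ y) (huc : u ≠ c)
    (hb : (A.neighborSet b).ncard + 1 = Nat.card K) (hc : (A.neighborSet c).ncard + 1 = Nat.card K)
    (hx : (A.neighborSet x).ncard + 1 = Nat.card K) (hy : (A.neighborSet y).ncard + 1 = Nat.card K)
    (ha : A.neighborSet a = ∅)
    (hfull : ∀ z, z ≠ a → z ≠ b → z ≠ c → z ≠ x → z ≠ y → (A.neighborSet z).ncard = Nat.card K)
    (aub : A.Adj u b) (aux : A.Adj u x) (auy : A.Adj u y) :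
    ∃ (M : A.EdgeColoring K) (k l : K), k ≠ l ∧ M.m k b = b ∧ M.m l c = c := by
  by_contra! hwin
  have same : ∀ (M : A.EdgeColoring K) (k l : K), M.m k b = b → M.m l c = c → k = l := by
    intro M k l h1 h2
    by_contra h
    exact hwin M k l h h1 h2
  have hfull' : ∀ z, z ≠ b → z ≠ c → z ≠ x → z ≠ y →
      A.neighborSet z = ∅ ∨ (A.neighborSet z).ncard = Nat.card K := by
    intro z h1 h2 h3 h4
    by_cases hz : z = a
    · left; rw [hz, ha]
    · exact Or.inr (hfull z hz h1 h2 h3 h4)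
  have missb : ∀ M : A.EdgeColoring K, ∃ k, M.m k b = b ∧ M.m k c = c := by
    intro M
    obtain ⟨k, hk⟩ := M.exists_missing (p := b) (by omega)
    obtain ⟨l, hl⟩ := M.exists_missing (p := c) (by omega)
    exact ⟨k, hk, by rwa [same M k l hk hl]⟩
  have isol : ∀ (M : A.EdgeColoring K) (k : K), M.m k a = a := by
    intro M k
    by_contra hk
    have : M.m k a ∈ A.neighborSet a := M.adj_of_eq rfl (Ne.symm hk)
    simp [ha] at this
  -- Every color is missing at an odd number of vertices. Since `a` misses all colors and `b`, `c`
  -- miss the same one, a color missing at `x` but not at `y` would be missing at two or four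
  -- vertices.
  have missx : ∀ (M : A.EdgeColoring K), ∃ k, M.m k x = x ∧ M.m k y = y := by
    intro M
    obtain ⟨β, hβb, hβc⟩ := missb M
    obtain ⟨k, hk⟩ := M.exists_missing (p := x) (by omega)
    refine ⟨k, hk, ?_⟩
    by_contra hky
    have hpar := M.ncard_fixed_modEq k
    have hsub : ∀ z, M.m k z = z → z = a ∨ z = b ∨ z = c ∨ z = x := by
      intro z hz
      by_contra! h
      by_cases hzy : z = y
      · exact hky (hzy ▸ hz)
      · exact M.ne_of_ncard_eq (hfull z h.1 h.2.1 h.2.2.1 h.2.2.2 hzy) k hz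
    have heven : Even {p | M.m k p = p}.ncard := by
      by_cases hkβ : k = β
      · subst hkβ
        have : {p | M.m k p = p} = {a, b, c, x} := by
          ext z
          constructor
          · intro hz
            simpa using hsub z hz
          · rintro (rfl | rfl | rfl | rfl)
            · exact isol M k
            · exact hβb
            · exact hβc
            · exact hk
        rw [this, Set.ncard_insert_of_notMem (by simp [hab, hac, hax]),
          Set.ncard_insert_of_notMem (by simp [hbc, hbx]), Set.ncard_pair hcx]
        decide
      · have : {p | M.m k p = p} = {a, x} := by
          ext z
          constructor
          · intro hz
            rcases hsub z hz with h | h | h | h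
            · simp [h]
            · subst h; exact absurd (M.missing_unique hb hz hβb) hkβ
            · subst h; exact absurd (M.missing_unique hc hz hβc) hkβ
            · simp [h]
          · rintro (rfl | rfl)
            · exact isol M k
            · exact hk
        rw [this, Set.ncard_pair hax]
        decide
    have h1 := Nat.odd_iff.1 hW
    have h2 := Nat.even_iff.1 heven
    unfold Nat.ModEq at hpar
    omega
  obtain ⟨M, k₀, Mb, Mc, Mx, My⟩ : ∃ (M : A.EdgeColoring K) (k₀ : K), M.m k₀ b = b ∧
      M.m k₀ c = c ∧ M.m k₀ x = x ∧ M.m k₀ y = y := by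
    obtain ⟨β, hβb, hβc⟩ := missb M
    obtain ⟨η, hηx, hηy⟩ := missx M
    by_cases h : β = η
    · exact ⟨M, β, hβb, hβc, h ▸ hηx, h ▸ hηy⟩
    -- This chain must end at `c`, as otherwise the exchange would separate `b` from `c`. After the
    -- exchange, `b` and `c` miss `η` just as `x` and `y` do.
    obtain ⟨S, q, bS, -, -, -, -, Sβ, Sη, Send⟩ := M.exists_chain (k := β) (l := η) (p := b)
      (Or.inl ⟨hβb, fun h' => h (M.missing_unique hb hβb h')⟩)
    let M' := M.kempe β η S Sβ Sη
    have M'b : M'.m η b = b := by rw [M.kempe_right Sβ Sη bS, hβb]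
    by_cases cS : c ∈ S
    · have hcq : c = q := (Send c cS (Or.inl hβc)).resolve_left hbc.symm
      have xS : x ∉ S := fun hS => (Send x hS (Or.inr hηx)).elim hbx.symm
        (fun h' => hcx (hcq.trans h'.symm))
      have yS : y ∉ S := fun hS => (Send y hS (Or.inr hηy)).elim hby.symm
        (fun h' => hcy (hcq.trans h'.symm))
      exact ⟨M', η, M'b, by rw [M.kempe_right Sβ Sη cS, hβc],
        by rw [M.kempe_of_notMem Sβ Sη xS, hηx], by rw [M.kempe_of_notMem Sβ Sη yS, hηy]⟩
    · exact absurd (same M' η β M'b (by rw [M.kempe_of_notMem Sβ Sη cS, hβc])) (Ne.symm h)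
  have hub := aub.ne
  have hux := aux.ne
  have huy := auy.ne
  obtain ⟨X, Mux⟩ := M.exists_color aux
  have h0X : k₀ ≠ X := by
    rintro rfl; exact hux ((M.symm_eq Mux).symm.trans Mx)
  -- Again the chain ends at `c`. It therefore avoids `x`, hence `u` along the edge `ux` of color
  -- `X`, hence the `k₀`-neighbor of `u`; the exchange makes `b` and `c` miss the color of `ux`.
  obtain ⟨S, q, bS, -, -, -, -, S0, SX, Send⟩ := M.exists_chain (k := k₀) (l := X) (p := b)
    (Or.inl ⟨Mb, fun h => h0X (M.missing_unique hb Mb h)⟩)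
  let M' := M.kempe k₀ X S S0 SX
  have M'b : M'.m X b = b := by rw [M.kempe_right S0 SX bS, Mb]
  by_cases cS : c ∈ S
  · have hcq : c = q := (Send c cS (Or.inl Mc)).resolve_left hbc.symm
    have xS : x ∉ S := fun hS => (Send x hS (Or.inl Mx)).elim hbx.symm
      (fun h' => hcx (hcq.trans h'.symm))
    have yS : y ∉ S := fun hS => (Send y hS (Or.inl My)).elim hby.symm
      (fun h' => hcy (hcq.trans h'.symm))
    have uS : u ∉ S := fun hS => xS (Mux ▸ SX u hS)
    have M'u : ∀ d, M'.m d u = M.m d u := M.kempe_of_notMem S0 SX uS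
    have notMem : M.m k₀ u ∉ S := M.compl_closed S0 u uS
    obtain ⟨M2, k, l, hkl, h1, h2⟩ := M'.exists_missing_ne_of_color_eq (u := u) hbc hbx hby hcx hcy
      hxy hub huc hux huy hb hx hy hfull' aub auy (k₀ := k₀) (X := X)
      (by rw [M'u]; rintro h; exact notMem (h ▸ bS)) (by rw [M'u]; rintro h; exact notMem (h ▸ cS))
      M'b (by rw [M.kempe_right S0 SX cS, Mc]) (by rw [M.kempe_of_notMem S0 SX xS, Mx])
      (by rw [M.kempe_of_notMem S0 SX yS, My]) (by rw [M'u, Mux])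
    exact hwin M2 k l hkl h1 h2
  · exact absurd (same M' X k₀ M'b (by rw [M.kempe_of_notMem S0 SX cS, Mc])) h0X.symm

/-! ### Fan and Kierstead path arguments at an uncolored edge `ab` -/

variable {W K : Type*} [Finite W] {A : SimpleGraph W} {a b c x : W}

/-- If no color is ever missing at both `a` and `b`, then a color missing at a third vertex `x` can
be traded against another one without changing the colors at `a` and `b`. -/
theorem exists_shift (hN : ∀ (M : A.EdgeColoring K) (k : K), M.m k a = a → M.m k b ≠ b)
    (hxa : x ≠ a) (hxb : x ≠ b) (M : A.EdgeColoring K) {α β : K}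
    (Ma : M.m α a = a) (Mb : M.m β b = b) (hx : M.m α x = x ∨ M.m β x = x) :
    ∃ M' : A.EdgeColoring K, (∀ c, c ≠ α → c ≠ β → ∀ z, M'.m c z = M.m c z) ∧
      (∀ c, M'.m c a = M.m c a) ∧ (∀ c, M'.m c b = M.m c b) ∧
      M'.m α x = M.m β x ∧ M'.m β x = M.m α x := by
  obtain ⟨S, q, aS, -, -, -, -, Sα, Sβ, Send⟩ := M.exists_chain (k := α) (l := β) (p := a)
    (Or.inl ⟨Ma, fun h => hN M β h Mb⟩)
  -- Otherwise the exchange on `S` would make `β` missing at both `a` and `b`.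
  have bS : b ∈ S := by
    by_contra bS
    refine hN (M.kempe α β S Sα Sβ) β ?_ ?_
    · rw [M.kempe_right Sα Sβ aS, Ma]
    · rw [M.kempe_of_notMem Sα Sβ bS, Mb]
  have hba : b ≠ a := by
    rintro rfl; exact hN M β Mb Mb
  have hbq : b = q := (Send b bS (Or.inr Mb)).resolve_left hba
  have xS : x ∉ S := fun h => (Send x h hx).elim hxa (fun h' => hxb (h'.trans hbq.symm))
  have Cα := M.compl_closed Sα
  have Cβ := M.compl_closed Sβ
  exact ⟨M.kempe α β Sᶜ Cα Cβ, fun c h1 h2 => M.kempe_of_ne Cα Cβ h1 h2,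
    M.kempe_of_notMem Cα Cβ (fun h => h aS), M.kempe_of_notMem Cα Cβ (fun h => h bS),
    M.kempe_left Cα Cβ xS, M.kempe_right Cα Cβ xS⟩

/-- If the missing colors of `a` and `b` always partition the set of colors, then no color is
missing at a neighbor of `a`. -/
theorem ne_of_adj (hN : ∀ (M : A.EdgeColoring K) (k : K), M.m k a = a → M.m k b ≠ b)
    (hcover : ∀ (M : A.EdgeColoring K) (k : K), M.m k a = a ∨ M.m k b = b)
    (ha : ∀ M : A.EdgeColoring K, ∃ k, M.m k a = a)
    (hxb : x ≠ b) (hax : A.Adj a x) (M : A.EdgeColoring K) (η : K) : M.m η x ≠ x := by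
  intro Mx
  have hba : b ≠ a := by
    rintro rfl
    obtain ⟨k, hk⟩ := ha M
    exact hN M k hk hk
  have main : ∀ (M : A.EdgeColoring K) (η : K), M.m η x = x → M.m η a ≠ a := by
    intro M η Mx Ma
    -- Recoloring `ax` from `γ` to `η` makes `γ` missing at `a` as well as at `b`.
    obtain ⟨γ, Mγ⟩ := M.exists_color hax
    have Mγb : M.m γ b = b := (hcover M γ).resolve_left (by rw [Mγ]; exact hax.ne')
    have P1 : ∀ z ∈ ({a, x} : Set W), M.m γ z ∈ ({a, x} : Set W) := by
      rintro z (rfl | rfl)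
      · rw [Mγ]; simp
      · rw [M.symm_eq Mγ]; simp
    have P2 : ∀ z ∈ ({a, x} : Set W), M.m η z ∈ ({a, x} : Set W) := by
      rintro z (rfl | rfl)
      · rw [Ma]; simp
      · rw [Mx]; simp
    refine hN (M.kempe γ η {a, x} P1 P2) γ ?_ ?_
    · rw [M.kempe_left P1 P2 (by simp), Ma]
    · rw [M.kempe_of_notMem P1 P2 (by simp [hba, hxb.symm]), Mγb]
  rcases hcover M η with h | h
  · exact main M η Mx h
  · obtain ⟨α, hα⟩ := ha M
    obtain ⟨M', -, h1, -, h2, -⟩ := exists_shift hN hax.ne' hxb M hα h (Or.inr Mx)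
    exact main M' α (h2.trans Mx) ((h1 α).trans hα)

/-- If the missing colors of `a` and `b` always partition the set of colors, and `b` misses more
than one color, then no color is missing at a vertex at distance two from `b`. -/
theorem ne_of_adj_of_adj (hN : ∀ (M : A.EdgeColoring K) (k : K), M.m k a = a → M.m k b ≠ b)
    (hcover : ∀ (M : A.EdgeColoring K) (k : K), M.m k a = a ∨ M.m k b = b)
    (hb : ∀ (M : A.EdgeColoring K) (d : K), ∃ k, M.m k b = b ∧ k ≠ d)
    (hab : a ≠ b) (hca : c ≠ a) (hxa : x ≠ a) (hxb : x ≠ b) (hbc : A.Adj b c) (hcx : A.Adj c x)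
    (M : A.EdgeColoring K) (η : K) : M.m η x ≠ x := by
  intro Mx
  -- The four claims grow more general, each reduced to an earlier one by `exists_shift`. Here `b`,
  -- `c`, `x` form an entire `α`-`γ` chain, and its exchange frees at `b` the color `α`, which `a`
  -- misses too.
  have ne_of_shared_color : ∀ (M : A.EdgeColoring K) (α γ : K), M.m α b = c → M.m γ c = x →
      M.m γ b = b →
      M.m α x ≠ x := by
    intro M α γ hα hγ hγb hx
    have hαa : M.m α a = a := (hcover M α).resolve_right (by rw [hα]; exact hbc.ne')
    have P1 : ∀ z ∈ ({b, c, x} : Set W), M.m α z ∈ ({b, c, x} : Set W) := by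
      rintro z (rfl | rfl | rfl)
      · rw [hα]; simp
      · rw [M.symm_eq hα]; simp
      · rw [hx]; simp
    have P2 : ∀ z ∈ ({b, c, x} : Set W), M.m γ z ∈ ({b, c, x} : Set W) := by
      rintro z (rfl | rfl | rfl)
      · rw [hγb]; simp
      · rw [hγ]; simp
      · rw [M.symm_eq hγ]; simp
    refine hN (M.kempe α γ {b, c, x} P1 P2) α ?_ ?_
    · rw [M.kempe_of_notMem P1 P2 (by simp [hab, hca.symm, hxa.symm]), hαa]
    · rw [M.kempe_left P1 P2 (by simp), hγb]
  have ne_of_two_missing : ∀ (M : A.EdgeColoring K) (γ η : K), M.m γ c = x → M.m γ b = b →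
      M.m η b = b →
      M.m η x ≠ x := by
    intro M γ η hγ hγb hηb hηx
    obtain ⟨α, hα⟩ := M.exists_color hbc
    have hαa : M.m α a = a := (hcover M α).resolve_right (by rw [hα]; exact hbc.ne')
    have h1 : γ ≠ α := M.map_ne_color hγb (by rw [hα]; exact hbc.ne')
    have h2 : γ ≠ η := M.map_ne_color (M.symm_eq hγ) (by rw [hηx]; exact hcx.ne')
    obtain ⟨M', e1, e2, e3, e4, e5⟩ := exists_shift hN hxa hxb M hαa hηb (Or.inr hηx)
    exact ne_of_shared_color M' α γ ((e3 α).trans hα) ((e1 γ h1 h2 c).trans hγ) ((e3 γ).trans hγb)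
      (e4.trans hηx)
  have ne_of_edge_missing : ∀ (M : A.EdgeColoring K) (γ η : K), M.m γ c = x → M.m γ b = b →
      M.m η x ≠ x := by
    intro M γ η hγ hγb hηx
    have h2 : γ ≠ η := M.map_ne_color (M.symm_eq hγ) (by rw [hηx]; exact hcx.ne')
    rcases hcover M η with h | h
    · obtain ⟨β, hβ, hβγ⟩ := hb M γ
      obtain ⟨M', e1, e2, e3, e4, e5⟩ := exists_shift hN hxa hxb M h hβ (Or.inl hηx)
      exact ne_of_two_missing M' γ β ((e1 γ h2 hβγ.symm c).trans hγ) ((e3 γ).trans hγb) ((e3 β).trans hβ)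
        (e5.trans hηx)
    · exact ne_of_two_missing M γ η hγ hγb h hηx
  have ne_of_missing : ∀ (M : A.EdgeColoring K) (η : K), M.m η b = b → M.m η x ≠ x := by
    intro M η hηb hηx
    obtain ⟨γ, hγ⟩ := M.exists_color hcx
    rcases hcover M γ with h | h
    · obtain ⟨M', e1, e2, e3, e4, e5⟩ := exists_shift hN hxa hxb M h hηb (Or.inr hηx)
      exact ne_of_edge_missing M' η γ (M'.symm_eq (e5.trans (M.symm_eq hγ))) ((e3 η).trans hηb) (e4.trans hηx)
    · exact ne_of_edge_missing M γ η hγ h hηx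
  rcases hcover M η with h | h
  · obtain ⟨β, hβ, -⟩ := hb M η
    obtain ⟨M', -, -, e3, -, e5⟩ := exists_shift hN hxa hxb M h hβ (Or.inl Mx)
    exact ne_of_missing M' β ((e3 β).trans hβ) (e5.trans Mx)
  · exact ne_of_missing M η h Mx

end EdgeColoring

/-! ### Restoring a deleted edge -/

theorem deleteEdges_comm {W : Type*} (G : SimpleGraph W) (s t : Set (Sym2 W)) :
    (G.deleteEdges s).deleteEdges t = (G.deleteEdges t).deleteEdges s := by
  rw [deleteEdges_deleteEdges, deleteEdges_deleteEdges, Set.union_comm]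

theorem deleteEdges_singleton_adj {W : Type*} (G : SimpleGraph W) (e : Sym2 W) (p q : W) :
    (G.deleteEdges {e}).Adj p q ↔ G.Adj p q ∧ s(p, q) ≠ e := by
  simp only [deleteEdges_adj, Set.mem_singleton_iff, ne_eq]

theorem deleteEdges_singleton_adj_of_ne {W : Type*} (G : SimpleGraph W) {p q x y : W}
    (h : G.Adj p q) (hx : p ≠ x) (hy : p ≠ y) : (G.deleteEdges {s(x, y)}).Adj p q := by
  rw [deleteEdges_singleton_adj, Ne, Sym2.eq_iff]
  tauto

namespace EdgeColoring

variable {W K : Type*} {G : SimpleGraph W}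

theorem nonempty_deleteEdges (M : G.EdgeColoring K) {p q : W} (h : G.Adj p q) :
    Nonempty ((G.deleteEdges {s(p, q)}).EdgeColoring K) := by
  obtain ⟨k, hk⟩ := M.exists_color h
  exact ⟨M.removeEdge hk h.ne _ (G.deleteEdges_singleton_adj _)⟩

theorem adj_iff_deleteEdges_or {p q : W} (h : G.Adj p q) (r t : W) :
    G.Adj r t ↔ (G.deleteEdges {s(p, q)}).Adj r t ∨ s(r, t) = s(p, q) := by
  rw [deleteEdges_singleton_adj]
  constructor
  · intro h
    by_cases hs : s(r, t) = s(p, q)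
    · exact Or.inr hs
    · exact Or.inl ⟨h, hs⟩
  · rintro (h' | h')
    · exact h'.1
    · rwa [← mem_edgeSet, h', mem_edgeSet]

theorem not_adj_deleteEdges {p q : W} : ¬ (G.deleteEdges {s(p, q)}).Adj p q := fun h =>
  ((G.deleteEdges_singleton_adj _ _ _).1 h).2 rfl

theorem nonempty_of_missing {p q : W} (h : G.Adj p q)
    (M : (G.deleteEdges {s(p, q)}).EdgeColoring K) {k : K} (hp : M.m k p = p) (hq : M.m k q = q) :
    Nonempty (G.EdgeColoring K) :=
  ⟨M.addEdge hp hq h.ne not_adj_deleteEdges G (adj_iff_deleteEdges_or h)⟩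

variable [Finite W] [Finite K] {a b : W}

/-- If the edge `ab` is missing and `a`, `b` have together fewer neighbors than there are colors,
then the edge `ab` can be colored. -/
theorem nonempty_of_ncard_lt (h : G.Adj a b) (M : (G.deleteEdges {s(a, b)}).EdgeColoring K)
    (hlt : (G.neighborSet a).ncard + (G.neighborSet b).ncard < Nat.card K + 2) :
    Nonempty (G.EdgeColoring K) := by
  have h1 := M.ncard_missing_add a
  have h2 := M.ncard_missing_add b
  have h3 := G.ncard_neighborSet_deleteEdges_left h
  have h4 := G.ncard_neighborSet_deleteEdges_right h
  have h5 : ¬ Disjoint {k | M.m k a = a} {k | M.m k b = b} := by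
    intro hd
    have h6 := Set.ncard_union_eq hd
    have h7 := Set.ncard_le_card ({k | M.m k a = a} ∪ {k | M.m k b = b})
    omega
  obtain ⟨k, hka, hkb⟩ := Set.not_disjoint_iff.1 h5
  exact nonempty_of_missing h M hka hkb

/-- The colors missing at `a` and at `b` form disjoint sets, whose sizes add up to the number of
colors by the degree sum. -/
theorem missing_or_missing (h : G.Adj a b) (hG : ¬ Nonempty (G.EdgeColoring K))
    (heq : (G.neighborSet a).ncard + (G.neighborSet b).ncard = Nat.card K + 2)
    (M : (G.deleteEdges {s(a, b)}).EdgeColoring K) (k : K) : M.m k a = a ∨ M.m k b = b := by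
  have h1 := M.ncard_missing_add a
  have h2 := M.ncard_missing_add b
  have h3 := G.ncard_neighborSet_deleteEdges_left h
  have h4 := G.ncard_neighborSet_deleteEdges_right h
  have hd : Disjoint {k | M.m k a = a} {k | M.m k b = b} :=
    Set.disjoint_left.2 fun k hka hkb => hG (nonempty_of_missing h M hka hkb)
  have h6 := Set.ncard_union_eq hd
  have h7 : {k | M.m k a = a} ∪ {k | M.m k b = b} = Set.univ := by
    rw [Set.eq_univ_iff_ncard]
    omega
  have h8 : k ∈ {k | M.m k a = a} ∪ {k | M.m k b = b} := by rw [h7]; trivial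
  exact h8

end EdgeColoring

/-! ### Common neighbors from the degree bound -/

section

variable {W : Type*} [Finite W] {G : SimpleGraph W} {a b x y : W} {d : ℕ}

/-- With `a` and the edge `xy` set aside, the three neighborhoods have `d - 1` elements each among
the `Nat.card W - 4` vertices other than `a`, `b`, `x`, `y`. Three such sets meet, as `3 * (d - 1)`
exceeds `2 * (Nat.card W - 4)`. -/
theorem exists_adj_adj_adj (hab : G.Adj a b) (hxy : G.Adj x y) (hxa : ¬ G.Adj a x)
    (hya : ¬ G.Adj a y) (hxb : ¬ G.Adj b x) (hyb : ¬ G.Adj b y) (hax : a ≠ x) (hay : a ≠ y)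
    (hbx : b ≠ x) (hby : b ≠ y)
    (hb : (G.neighborSet b).ncard = d) (hx : (G.neighborSet x).ncard = d)
    (hy : (G.neighborSet y).ncard = d) (hd : 3 * Nat.card W ≤ 4 * d + 3) :
    ∃ u, G.Adj u b ∧ G.Adj u x ∧ G.Adj u y := by
  set T : Set W := {a, b, x, y}ᶜ with hT
  have hTc : T.ncard + 4 = Nat.card W := by
    rw [hT, ← Set.ncard_add_ncard_compl ({a, b, x, y} : Set W),
      Set.ncard_insert_of_notMem (by simp [hab.ne, hax, hay]),
      Set.ncard_insert_of_notMem (by simp [hbx, hby]), Set.ncard_pair hxy.ne]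
    omega
  have hP : (G.neighborSet b \ {a}).ncard + 1 = d := by
    rw [← hb]; exact Set.ncard_sdiff_singleton_add_one hab.symm
  have hQ : (G.neighborSet x \ {y}).ncard + 1 = d := by
    rw [← hx]; exact Set.ncard_sdiff_singleton_add_one hxy
  have hR : (G.neighborSet y \ {x}).ncard + 1 = d := by
    rw [← hy]; exact Set.ncard_sdiff_singleton_add_one hxy.symm
  have sP : G.neighborSet b \ {a} ⊆ T := by
    rintro z ⟨h1, h2⟩ (rfl | rfl | rfl | rfl)
    exacts [h2 rfl, h1.ne rfl, hxb h1, hyb h1]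
  have sQ : G.neighborSet x \ {y} ⊆ T := by
    rintro z ⟨h1, h2⟩ (rfl | rfl | rfl | rfl)
    exacts [hxa h1.symm, hxb h1.symm, h1.ne rfl, h2 rfl]
  have sR : G.neighborSet y \ {x} ⊆ T := by
    rintro z ⟨h1, h2⟩ (rfl | rfl | rfl | rfl)
    exacts [hya h1.symm, hyb h1.symm, h2 rfl, h1.ne rfl]
  have i1 := Set.ncard_union_add_ncard_inter (G.neighborSet b \ {a}) (G.neighborSet x \ {y})
  have i2 := Set.ncard_union_add_ncard_inter
    (G.neighborSet b \ {a} ∩ (G.neighborSet x \ {y})) (G.neighborSet y \ {x})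
  have i3 := Set.ncard_le_ncard (Set.union_subset sP sQ)
  have i4 := Set.ncard_le_ncard (Set.union_subset (Set.inter_subset_left.trans sP) sR :
    G.neighborSet b \ {a} ∩ (G.neighborSet x \ {y}) ∪ G.neighborSet y \ {x} ⊆ T)
  have i5 : 0 < (G.neighborSet b \ {a} ∩ (G.neighborSet x \ {y}) ∩
      (G.neighborSet y \ {x})).ncard := by
    omega
  obtain ⟨u, ⟨h1, h2⟩, h3⟩ := (Set.ncard_pos).1 i5
  exact ⟨u, h1.1.symm, h2.1.symm, h3.1.symm⟩

/-- Otherwise the neighborhoods of `a`, `b`, `x` would be disjoint, with `2 * d + 2` vertices in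
total, more than there are. -/
theorem exists_adj_adj_or_adj (hdisj : ∀ z, G.Adj a z → ¬ G.Adj b z)
    (hsum : (G.neighborSet a).ncard + (G.neighborSet b).ncard = d + 2)
    (hx : (G.neighborSet x).ncard = d) (hd : 3 * Nat.card W ≤ 4 * d + 3) :
    ∃ c, G.Adj x c ∧ (G.Adj a c ∨ G.Adj b c) := by
  by_contra! h
  have h1 : Disjoint (G.neighborSet a) (G.neighborSet b) := Set.disjoint_left.2 hdisj
  have h2 : Disjoint (G.neighborSet a ∪ G.neighborSet b) (G.neighborSet x) := by
    rw [Set.disjoint_left]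
    rintro z (hz | hz) hzx
    · exact (h z hzx).1 hz
    · exact (h z hzx).2 hz
  have h3 := Set.ncard_union_eq h1
  have h4 := Set.ncard_union_eq h2
  have h5 := Set.ncard_le_card (G.neighborSet a ∪ G.neighborSet b ∪ G.neighborSet x)
  omega

end

/-! ### Every edge is critical -/

namespace EdgeColoring

variable {W K : Type*} [Finite W] [Finite K] {G : SimpleGraph W} {a b x y : W}

/-- If `a` has degree two, then an edge `xy` at distance at least two from `a` and `b` is
critical. -/
theorem nonempty_deleteEdges_of_degree_two (hW : Odd (Nat.card W))
    (hd : 3 * Nat.card W ≤ 4 * Nat.card K + 3)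
    (M : (G.deleteEdges {s(a, b)}).EdgeColoring K) (hab : G.Adj a b)
    (hdisj : ∀ z, G.Adj a z → ¬ G.Adj b z)
    (ha : (G.neighborSet a).ncard = 2) (hb : (G.neighborSet b).ncard = Nat.card K)
    (hreg : ∀ z, z ≠ a → z ≠ b → (G.neighborSet z).ncard = Nat.card K)
    (hxy : G.Adj x y) (hax : a ≠ x) (hay : a ≠ y) (hbx : b ≠ x) (hby : b ≠ y)
    (hxa : ¬ G.Adj a x) (hya : ¬ G.Adj a y) (hxb : ¬ G.Adj b x) (hyb : ¬ G.Adj b y) :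
    Nonempty ((G.deleteEdges {s(x, y)}).EdgeColoring K) := by
  obtain ⟨u, aub, aux, auy⟩ := exists_adj_adj_adj hab hxy hxa hya hxb hyb hax hay hbx hby hb
    (hreg x hax.symm hbx.symm) (hreg y hay.symm hby.symm) hd
  obtain ⟨c, hac, hcb⟩ := Set.exists_ne_of_one_lt_ncard (s := G.neighborSet a) (by omega) b
  have hac : G.Adj a c := hac
  have hcx : c ≠ x := by rintro rfl; exact hxa hac
  have hcy : c ≠ y := by rintro rfl; exact hya hac
  have hua : u ≠ a := by rintro rfl; exact hxa aux
  have hux := aux.ne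
  have huy := auy.ne
  have huc : u ≠ c := by rintro rfl; exact hdisj u hac aub.symm
  set G1 := G.deleteEdges {s(x, y)} with hG1
  set G2 := G1.deleteEdges {s(a, b)} with hG2
  set G3 := G2.deleteEdges {s(a, c)} with hG3
  have hab1 : G1.Adj a b := G.deleteEdges_singleton_adj_of_ne hab hax hay
  have hac1 : G1.Adj a c := G.deleteEdges_singleton_adj_of_ne hac hax hay
  have hac2 : G2.Adj a c := (G1.deleteEdges_singleton_adj_of_ne hac1.symm hac.ne' hcb).symm
  have hxy0 : (G.deleteEdges {s(a, b)}).Adj x y :=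
    G.deleteEdges_singleton_adj_of_ne hxy hax.symm hbx.symm
  obtain ⟨M2⟩ := M.nonempty_deleteEdges hxy0
  rw [deleteEdges_comm, ← hG1, ← hG2] at M2
  obtain ⟨M3⟩ := M2.nonempty_deleteEdges hac2
  rw [← hG3] at M3
  have n1 : ∀ z, z ≠ x → z ≠ y → G1.neighborSet z = G.neighborSet z := fun z =>
    G.neighborSet_deleteEdges_of_ne
  have n2 : ∀ z, z ≠ a → z ≠ b → G2.neighborSet z = G1.neighborSet z := fun z =>
    G1.neighborSet_deleteEdges_of_ne
  have n3 : ∀ z, z ≠ a → z ≠ c → G3.neighborSet z = G2.neighborSet z := fun z =>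
    G2.neighborSet_deleteEdges_of_ne
  have e1x := G.ncard_neighborSet_deleteEdges_left hxy
  have e1y := G.ncard_neighborSet_deleteEdges_right hxy
  have e2a := G1.ncard_neighborSet_deleteEdges_left hab1
  have e2b := G1.ncard_neighborSet_deleteEdges_right hab1
  have e3a := G2.ncard_neighborSet_deleteEdges_left hac2
  have e3c := G2.ncard_neighborSet_deleteEdges_right hac2
  rw [← hG1] at e1x e1y
  rw [← hG2] at e2a e2b
  rw [← hG3] at e3a e3c
  have d3a : G3.neighborSet a = ∅ := by
    rw [← Set.ncard_eq_zero]
    rw [n1 a hax hay] at e2a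
    omega
  have d3b : (G3.neighborSet b).ncard + 1 = Nat.card K := by
    rw [n3 b hab.ne' hcb.symm, e2b, n1 b hbx hby, hb]
  have d3c : (G3.neighborSet c).ncard + 1 = Nat.card K := by
    rw [e3c, n2 c hac.ne' hcb, n1 c hcx hcy, hreg c hac.ne' hcb]
  have d3x : (G3.neighborSet x).ncard + 1 = Nat.card K := by
    rw [n3 x hax.symm hcx.symm, n2 x hax.symm hbx.symm, e1x, hreg x hax.symm hbx.symm]
  have d3y : (G3.neighborSet y).ncard + 1 = Nat.card K := by
    rw [n3 y hay.symm hcy.symm, n2 y hay.symm hby.symm, e1y, hreg y hay.symm hby.symm]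
  have adj3 : ∀ z, G.Adj u z → G3.Adj u z := fun z h =>
    G2.deleteEdges_singleton_adj_of_ne (G1.deleteEdges_singleton_adj_of_ne
      (G.deleteEdges_singleton_adj_of_ne h hux huy) hua aub.ne) hua huc
  obtain ⟨M', k, l, hkl, h1, h2⟩ := M3.exists_missing_ne_of_common_neighbor (u := u) hW hab.ne
    hac.ne hax hay hcb.symm hbx hby hcx hcy hxy.ne huc d3b d3c d3x d3y d3a
    (by
      intro z za zb zc zx zy
      rw [n3 z za zc, n2 z za zb, n1 z zx zy, hreg z za zb])
    (adj3 b aub) (adj3 x aux) (adj3 y auy)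
  have isol : ∀ k, M'.m k a = a := by
    intro k
    by_contra hk
    have : M'.m k a ∈ G3.neighborSet a := M'.adj_of_eq rfl (Ne.symm hk)
    simp [d3a] at this
  -- The edge `ac` gets `l`; as `k ≠ l`, the color `k` stays missing at `a` and `b` and is free for
  -- `ab`.
  let M4 := M'.addEdge (isol l) h2 hac.ne not_adj_deleteEdges G2 (adj_iff_deleteEdges_or hac2)
  have M4k : ∀ z, M4.m k z = M'.m k z :=
    M'.addEdge_of_ne (isol l) h2 hac.ne not_adj_deleteEdges G2 (adj_iff_deleteEdges_or hac2) hkl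
  exact nonempty_of_missing hab1 M4 ((M4k a).trans (isol k)) ((M4k b).trans h1)

/-- If `ab` is an edge such that `a` and `b` have no common neighbor and have degree sum two more
than the number of colors, all other vertices have as many neighbors as there are colors, and all
edges but `ab` can be colored, then all edges but any given one can be colored. -/
theorem nonempty_deleteEdges_of_degree_sum (hW : Odd (Nat.card W))
    (hd : 3 * Nat.card W ≤ 4 * Nat.card K + 3)
    (M : (G.deleteEdges {s(a, b)}).EdgeColoring K) (hab : G.Adj a b)
    (hdisj : ∀ z, G.Adj a z → ¬ G.Adj b z)
    (hsum : (G.neighborSet a).ncard + (G.neighborSet b).ncard = Nat.card K + 2)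
    (ha : 2 ≤ (G.neighborSet a).ncard) (hb : 2 ≤ (G.neighborSet b).ncard)
    (hreg : ∀ z, z ≠ a → z ≠ b → (G.neighborSet z).ncard = Nat.card K) (hxy : G.Adj x y) :
    Nonempty ((G.deleteEdges {s(x, y)}).EdgeColoring K) := by
  by_cases heq : s(x, y) = s(a, b)
  · rw [heq]; exact ⟨M⟩
  have hxy0 : (G.deleteEdges {s(a, b)}).Adj x y := (G.deleteEdges_singleton_adj _ _ _).2 ⟨hxy, heq⟩
  have hab1 : (G.deleteEdges {s(x, y)}).Adj a b :=
    (G.deleteEdges_singleton_adj _ _ _).2 ⟨hab, Ne.symm heq⟩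
  obtain ⟨M2⟩ := M.nonempty_deleteEdges hxy0
  rw [deleteEdges_comm] at M2
  by_contra hG
  have hle : ∀ z, ((G.deleteEdges {s(x, y)}).neighborSet z).ncard ≤ (G.neighborSet z).ncard :=
    fun z => Set.ncard_le_ncard fun t ht => ((G.deleteEdges_singleton_adj _ _ _).1 ht).1
  have ex := G.ncard_neighborSet_deleteEdges_left hxy
  have ey := G.ncard_neighborSet_deleteEdges_right hxy
  -- If `xy` met `ab`, its deletion would lower the degree sum, and `a` and `b` would miss a common
  -- color.
  have hlt : ¬ ((G.deleteEdges {s(x, y)}).neighborSet a).ncard +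
      ((G.deleteEdges {s(x, y)}).neighborSet b).ncard < Nat.card K + 2 :=
    fun h => hG (nonempty_of_ncard_lt hab1 M2 h)
  have ha' := hle a
  have hb' := hle b
  have hax : a ≠ x := by rintro rfl; omega
  have hay : a ≠ y := by rintro rfl; omega
  have hbx : b ≠ x := by rintro rfl; omega
  have hby : b ≠ y := by rintro rfl; omega
  set G1 := G.deleteEdges {s(x, y)} with hG1
  set G2 := G1.deleteEdges {s(a, b)} with hG2
  have n1 : ∀ z, z ≠ x → z ≠ y → G1.neighborSet z = G.neighborSet z := fun z =>
    G.neighborSet_deleteEdges_of_ne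
  have n2 : ∀ z, z ≠ a → z ≠ b → G2.neighborSet z = G1.neighborSet z := fun z =>
    G1.neighborSet_deleteEdges_of_ne
  have e2a := G1.ncard_neighborSet_deleteEdges_left hab1
  have e2b := G1.ncard_neighborSet_deleteEdges_right hab1
  rw [← hG2] at e2a e2b
  rw [n1 a hax hay] at e2a ha'
  rw [n1 b hbx hby] at e2b hb'
  have hN : ∀ (M : G2.EdgeColoring K) (k : K), M.m k a = a → M.m k b ≠ b := fun M k h1 h2 =>
    hG (nonempty_of_missing hab1 M h1 h2)
  have hN' : ∀ (M : G2.EdgeColoring K) (k : K), M.m k b = b → M.m k a ≠ a := fun M k h1 h2 =>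
    hN M k h2 h1
  have hcover : ∀ (M : G2.EdgeColoring K) (k : K), M.m k a = a ∨ M.m k b = b :=
    missing_or_missing hab1 hG (by rw [n1 a hax hay, n1 b hbx hby, hsum])
  have hcover' := fun (M : G2.EdgeColoring K) (k : K) => (hcover M k).symm
  obtain ⟨η, hη⟩ := M2.exists_missing (p := x) (by
    rw [n2 x hax.symm hbx.symm]; have := hreg x hax.symm hbx.symm; omega)
  obtain ⟨θ, hθ⟩ := M2.exists_missing (p := y) (by
    rw [n2 y hay.symm hby.symm]; have := hreg y hay.symm hby.symm; omega)
  have lift : ∀ p q, p ≠ x → p ≠ y → q ≠ a → q ≠ b → G.Adj p q → G2.Adj p q :=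
    fun p q h1 h2 h3 h4 h =>
    (G1.deleteEdges_singleton_adj_of_ne
      (G.deleteEdges_singleton_adj_of_ne h h1 h2).symm h3 h4).symm
  have missa : ∀ M : G2.EdgeColoring K, ∃ k, M.m k a = a := fun M =>
    M.exists_missing (by omega)
  have missb : ∀ M : G2.EdgeColoring K, ∃ k, M.m k b = b := fun M =>
    M.exists_missing (by omega)
  have hxa : ¬ G.Adj a x := fun h => ne_of_adj hN hcover missa hbx.symm
    (lift a x hax hay hax.symm hbx.symm h) M2 η hη
  have hya : ¬ G.Adj a y := fun h => ne_of_adj hN hcover missa hby.symm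
    (lift a y hax hay hay.symm hby.symm h) M2 θ hθ
  have hxb : ¬ G.Adj b x := fun h => ne_of_adj hN' hcover' missb hax.symm
    (lift b x hbx hby hax.symm hbx.symm h) M2 η hη
  have hyb : ¬ G.Adj b y := fun h => ne_of_adj hN' hcover' missb hay.symm
    (lift b y hbx hby hay.symm hby.symm h) M2 θ hθ
  -- A vertex of full degree misses only one color once `ab` is deleted, too few for
  -- `ne_of_adj_of_adj`; the other end of `ab` then has degree two.
  by_cases hbK : (G.neighborSet b).ncard = Nat.card K
  · exact hG (nonempty_deleteEdges_of_degree_two hW hd M hab hdisj (by omega) hbK hreg hxy hax hay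
      hbx hby hxa hya hxb hyb)
  by_cases haK : (G.neighborSet a).ncard = Nat.card K
  · rw [Sym2.eq_swap] at M
    exact hG (nonempty_deleteEdges_of_degree_two hW hd M hab.symm (fun z h1 h2 => hdisj z h2 h1)
      (by omega) haK (fun z h1 h2 => hreg z h2 h1) hxy hbx hby hax hay hxb hyb hxa hya)
  obtain ⟨c, hxc, hc⟩ := exists_adj_adj_or_adj hdisj hsum (hreg x hax.symm hbx.symm) hd
  have hca : c ≠ a := by rintro rfl; exact hxa hxc.symm
  have hcb : c ≠ b := by rintro rfl; exact hxb hxc.symm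
  have hcy : c ≠ y := by rintro rfl; exact hc.elim hya hyb
  have hcx2 : G2.Adj c x := lift c x hxc.ne' hcy hax.symm hbx.symm hxc.symm
  rcases hc with hc | hc
  · exact ne_of_adj_of_adj hN' hcover' (fun M d => M.exists_missing_ne (by omega) d) hab.ne' hcb
      hbx.symm hax.symm (lift a c hax hay hca hcb hc) hcx2 M2 η hη
  · exact ne_of_adj_of_adj hN hcover (fun M d => M.exists_missing_ne (by omega) d) hab.ne hca
      hax.symm hbx.symm (lift b c hbx hby hca hcb hc) hcx2 M2 η hη

/-! ### Transfer from and to line graphs, subgraphs and isomorphic graphs -/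

variable {V W K : Type*}

open Classical in
/-- The edge coloring given by a coloring of the line graph. -/
noncomputable def ofLineGraph {G : SimpleGraph V} (C : G.lineGraph.Coloring K) :
    G.EdgeColoring K :=
  have key : ∀ {c : K} {p q r : V} (hq : G.Adj p q) (hr : G.Adj p r), C ⟨s(p, q), hq⟩ = c →
      C ⟨s(p, r), hr⟩ = c → q = r := by
    intro c p q r hq hr h1 h2
    by_contra hne
    refine C.valid (v := ⟨s(p, q), hq⟩) (w := ⟨s(p, r), hr⟩) ⟨?_, p, ?_⟩ (h1.trans h2.symm)
    · intro h
      exact hne (Sym2.congr_right.1 (congrArg Subtype.val h))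
    · simp
  have symm : ∀ {c : K} {p q : V} (hq : G.Adj p q), C ⟨s(p, q), hq⟩ = c →
      C ⟨s(q, p), hq.symm⟩ = c := by
    intro c p q hq h
    rw [← h]
    congr 2
    exact Sym2.eq_swap
  have spec : ∀ (c : K) {p q : V} (hq : G.Adj p q), C ⟨s(p, q), hq⟩ = c →
      (if h : ∃ q, ∃ hq : G.Adj p q, C ⟨s(p, q), hq⟩ = c then h.choose else p) = q := by
    intro c p q hq h
    have hex : ∃ q, ∃ hq : G.Adj p q, C ⟨s(p, q), hq⟩ = c := ⟨q, hq, h⟩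
    rw [dif_pos hex]
    exact key hex.choose_spec.1 hq hex.choose_spec.2 h
  have spec' : ∀ (c : K) {p q : V}, p ≠ q →
      (if h : ∃ q, ∃ hq : G.Adj p q, C ⟨s(p, q), hq⟩ = c then h.choose else p) = q →
      ∃ hq : G.Adj p q, C ⟨s(p, q), hq⟩ = c := by
    intro c p q hne h
    split_ifs at h with hex
    · rw [← h]; exact hex.choose_spec
    · exact absurd h hne
  { m := fun c p => if h : ∃ q, ∃ hq : G.Adj p q, C ⟨s(p, q), hq⟩ = c then h.choose else p
    invol := by
      intro c p
      by_cases h : ∃ q, ∃ hq : G.Adj p q, C ⟨s(p, q), hq⟩ = c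
      · obtain ⟨q, hq, hc⟩ := h
        rw [spec c hq hc, spec c hq.symm (symm hq hc)]
      · simp only [dif_neg h]
    adj_iff := by
      intro p q
      constructor
      · intro h
        exact ⟨h.ne, _, spec _ h rfl⟩
      · rintro ⟨hne, c, hc⟩
        exact (spec' c hne hc).1
    inj := by
      intro c d p h hne
      obtain ⟨_, h1⟩ := spec' c hne.symm rfl
      obtain ⟨_, h2⟩ := spec' d (q := _) (by rw [← h]; exact hne.symm) rfl
      rw [← h1, ← h2]
      congr 3 }

theorem nonempty_of_colorable {G : SimpleGraph V} {d : ℕ} (h : G.lineGraph.Colorable d) :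
    Nonempty (G.EdgeColoring (Fin d)) :=
  h.elim fun C => ⟨ofLineGraph C⟩

/-- An edge coloring colors the line graph. -/
theorem nonempty_lineGraph_coloring {G : SimpleGraph V} (M : G.EdgeColoring K) :
    Nonempty (G.lineGraph.Coloring K) := by
  have h : ∀ e : G.edgeSet, ∃ c, ∀ p q, s(p, q) = (e : Sym2 V) → M.m c p = q := by
    rintro ⟨e, he⟩
    induction e with
    | h p q =>
      obtain ⟨c, hc⟩ := M.exists_color he
      refine ⟨c, fun r t hrt => ?_⟩
      rcases Sym2.eq_iff.1 hrt with ⟨rfl, rfl⟩ | ⟨rfl, rfl⟩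
      · exact hc
      · exact M.symm_eq hc
  choose C hC using h
  refine ⟨Coloring.mk C ?_⟩
  rintro e f ⟨hne, p, hpe, hpf⟩ hef
  obtain ⟨q, hq⟩ := hpe
  obtain ⟨r, hr⟩ := hpf
  refine hne (Subtype.ext ?_)
  rw [hq, hr]
  have h1 := hC e p q hq.symm
  have h2 := hC f p r hr.symm
  rw [hef] at h1
  rw [← h1, ← h2]

theorem colorable {G : SimpleGraph V} {d : ℕ} (M : G.EdgeColoring (Fin d)) :
    G.lineGraph.Colorable d :=
  M.nonempty_lineGraph_coloring

/-- A subgraph without the edge `e` is a copy inside `G - e`, and the copy embeds the line graphs.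
-/
theorem colorable_coe_of_notMem {G : SimpleGraph V} {d : ℕ} {e : Sym2 V}
    (M : (G.deleteEdges {e}).EdgeColoring (Fin d)) (H : G.Subgraph) (he : e ∉ H.edgeSet) :
    H.coe.lineGraph.Colorable d := by
  let f : H.coe →g G.deleteEdges {e} :=
    { toFun := Subtype.val
      map_rel' := by
        intro p q h
        refine (G.deleteEdges_singleton_adj _ _ _).2 ⟨H.adj_sub h, ?_⟩
        rintro rfl
        exact he h }
  let g : Copy H.coe (G.deleteEdges {e}) := ⟨f, Subtype.val_injective⟩
  exact M.colorable.of_hom g.toLineGraphEmbedding.toHom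

/-- A new color can be given to an additional edge. -/
theorem nonempty_option {G : SimpleGraph V} {a b : V} (h : G.Adj a b)
    (M : (G.deleteEdges {s(a, b)}).EdgeColoring K) : Nonempty (G.EdgeColoring (Option K)) := by
  let M' : (G.deleteEdges {s(a, b)}).EdgeColoring (Option K) :=
    { m := fun c p => c.elim p (fun k => M.m k p)
      invol := by rintro (_ | k) p <;> simp [M.invol]
      adj_iff := by
        intro p q
        rw [M.adj_iff]
        refine and_congr_right fun hne => ⟨fun ⟨k, hk⟩ => ⟨some k, hk⟩, ?_⟩
        rintro ⟨_ | k, hk⟩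
        · exact absurd hk hne
        · exact ⟨k, hk⟩
      inj := by
        rintro (_ | k) (_ | l) p h1 h2
        · rfl
        · exact absurd rfl h2
        · exact absurd h1 h2
        · exact congrArg some (M.inj k l p h1 h2) }
  exact nonempty_of_missing h M' (k := none) rfl rfl

/-- The edge colorings of an isomorphic graph. -/
def congr {G : SimpleGraph V} {H : SimpleGraph W} (f : G ≃g H) (M : G.EdgeColoring K) :
    H.EdgeColoring K where
  m c p := f (M.m c (f.symm p))
  invol c p := by simp [M.invol]
  adj_iff p q := by
    rw [← f.symm.map_adj_iff, M.adj_iff]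
    refine and_congr (not_congr f.symm.injective.eq_iff) (exists_congr fun c => ?_)
    rw [← f.injective.eq_iff, RelIso.apply_symm_apply]
  inj c d p h hne := by
    refine M.inj c d (f.symm p) (f.injective h) fun h' => hne ?_
    rw [h', RelIso.apply_symm_apply]

/-! ### Edge colorings under vertex-splitting -/

open Classical in
/-- The color class of `c` after a vertex-splitting. -/
noncomputable def splitMap {G : SimpleGraph V} (M : G.EdgeColoring K) (v : V) (N : Fin 2 → Set V)
    (c : K) : {u : V // u ≠ v} ⊕ Fin 2 → {u : V // u ≠ v} ⊕ Fin 2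
  | Sum.inl p => if h : M.m c p.1 = v then (if p.1 ∈ N 0 then Sum.inr 0 else Sum.inr 1)
      else Sum.inl ⟨M.m c p.1, h⟩
  | Sum.inr i => if h : M.m c v ∈ N i ∧ M.m c v ≠ v then Sum.inl ⟨M.m c v, h.2⟩ else Sum.inr i

section split

variable {G : SimpleGraph V} (M : G.EdgeColoring K) {v : V} {N : Fin 2 → Set V}

theorem splitMap_inl_eq_inl {c : K} {p q : {u : V // u ≠ v}} :
    M.splitMap v N c (Sum.inl p) = Sum.inl q ↔ M.m c p.1 = q.1 := by
  unfold splitMap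
  dsimp only
  split_ifs with h1 h2
  · simp only [false_iff]
    intro h; exact q.2 (h.symm.trans h1)
  · simp only [false_iff]
    intro h; exact q.2 (h.symm.trans h1)
  · rw [Sum.inl.injEq, Subtype.ext_iff]

theorem splitMap_inr_eq_inl {c : K} {i : Fin 2} {q : {u : V // u ≠ v}} :
    M.splitMap v N c (Sum.inr i) = Sum.inl q ↔ q.1 ∈ N i ∧ M.m c v = q.1 := by
  unfold splitMap
  dsimp only
  split_ifs with h
  · rw [Sum.inl.injEq, Subtype.ext_iff]
    exact ⟨fun h1 => ⟨h1 ▸ h.1, h1⟩, fun h1 => h1.2⟩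
  · simp only [false_iff]
    rintro ⟨h1, h2⟩
    exact h ⟨h2 ▸ h1, h2 ▸ q.2⟩

theorem splitMap_inr_eq_inr {c : K} {i j : Fin 2}
    (h : M.splitMap v N c (Sum.inr i) = Sum.inr j) : i = j := by
  unfold splitMap at h
  dsimp only at h
  split_ifs at h
  exact Sum.inr_injective h

/-- Disjointness makes the choice between the two new vertices unambiguous; that `N 0` and `N 1`
cover the neighborhood of `v` justifies the default `Sum.inr 1`. -/
theorem splitMap_inl_eq_inr (hd : Disjoint (N 0) (N 1)) (hN : N 0 ∪ N 1 = G.neighborSet v) {c : K}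
    {p : {u : V // u ≠ v}} {i : Fin 2} :
    M.splitMap v N c (Sum.inl p) = Sum.inr i ↔ p.1 ∈ N i ∧ M.m c v = p.1 := by
  rw [M.eq_iff (p := v)]
  have h0 : M.m c p.1 = v → p.1 ∉ N 0 → p.1 ∈ N 1 := by
    intro h h'
    have : p.1 ∈ N 0 ∪ N 1 := by rw [hN]; exact (M.adj_of_eq h p.2).symm
    exact this.resolve_left h'
  have h1 : p.1 ∈ N 0 → p.1 ∉ N 1 := fun h h' => Set.disjoint_left.1 hd h h'
  unfold splitMap
  dsimp only
  split_ifs with h2 h3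
  · fin_cases i
    · simp [h2, h3]
    · simp [h1 h3]
  · fin_cases i
    · simp [h3]
    · simp [h2, h0 h2 h3]
  · simp [h2]

/-- The edge coloring of the graph obtained by a vertex-splitting, without the new edge. -/
noncomputable def split (hd : Disjoint (N 0) (N 1)) (hN : N 0 ∪ N 1 = G.neighborSet v) :
    ((G.splitAt v N).deleteEdges {s(Sum.inr 0, Sum.inr 1)}).EdgeColoring K where
  m := M.splitMap v N
  invol := by
    intro c z
    obtain ⟨t, ht⟩ : ∃ t, M.splitMap v N c z = t := ⟨_, rfl⟩
    rw [ht]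
    rcases z with p | i <;> rcases t with q | j
    · rw [splitMap_inl_eq_inl] at ht ⊢
      exact M.symm_eq ht
    · rwa [splitMap_inr_eq_inl, ← M.splitMap_inl_eq_inr hd hN]
    · rwa [M.splitMap_inl_eq_inr hd hN, ← splitMap_inr_eq_inl]
    · obtain rfl := M.splitMap_inr_eq_inr ht
      exact ht
  adj_iff := by
    have hadj : ∀ {i : Fin 2} {p : V}, p ∈ N i → ∃ c, M.m c v = p := by
      intro i p h
      have : p ∈ N 0 ∪ N 1 := by
        fin_cases i
        · exact Or.inl h
        · exact Or.inr h
      rw [hN] at this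
      exact M.exists_color this
    intro z t
    rw [deleteEdges_singleton_adj]
    rcases z with p | i <;> rcases t with q | j
    · simp only [splitMap_inl_eq_inl, ne_eq, Sum.inl.injEq, Subtype.ext_iff, ← M.adj_iff]
      simp [splitAt]
    · simp only [M.splitMap_inl_eq_inr hd hN]
      simpa [splitAt] using hadj
    · simp only [splitMap_inr_eq_inl]
      simpa [splitAt] using hadj
    · have h1 : ¬ ∃ c, Sum.inr i ≠ (Sum.inr j : {u : V // u ≠ v} ⊕ Fin 2) ∧
          M.splitMap v N c (Sum.inr i) = Sum.inr j := fun ⟨c, h, h'⟩ =>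
        h (congrArg _ (M.splitMap_inr_eq_inr h'))
      rw [← exists_and_left]
      refine iff_of_false ?_ h1
      rintro ⟨h2, h3⟩
      have h2 : i ≠ j := h2
      fin_cases i <;> fin_cases j <;> simp_all [Sym2.eq_swap]
  inj := by
    intro c d z h hne
    obtain ⟨t, ht⟩ : ∃ t, M.splitMap v N d z = t := ⟨_, rfl⟩
    rw [h, ht] at hne
    rw [ht] at h
    rcases z with p | i <;> rcases t with q | j
    · rw [splitMap_inl_eq_inl] at ht h
      exact M.color_unique h ht (fun h' => hne (by rw [Subtype.ext h']))
    · rw [M.splitMap_inl_eq_inr hd hN] at ht h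
      exact M.color_unique h.2 ht.2 p.2.symm
    · rw [splitMap_inr_eq_inl] at ht h
      exact M.color_unique h.2 ht.2 q.2.symm
    · exact absurd (congrArg _ (M.splitMap_inr_eq_inr ht).symm) hne

end split

end EdgeColoring

/-! ### Degrees, class and criticality -/

/-- An isomorphism restricts to the graphs obtained by the deletion of corresponding edges. -/
def Iso.deleteEdge {V W : Type*} {G : SimpleGraph V} {H : SimpleGraph W} (f : G ≃g H) (p q : V) :
    G.deleteEdges {s(p, q)} ≃g H.deleteEdges {s(f p, f q)} where
  toEquiv := f.toEquiv
  map_rel_iff' := by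
    intro r t
    rw [deleteEdges_singleton_adj, deleteEdges_singleton_adj]
    refine and_congr f.map_adj_iff (not_congr ?_)
    simp [f.injective.eq_iff]

theorem Iso.ncard_neighborSet {V W : Type*} {G : SimpleGraph V} {H : SimpleGraph W} (f : G ≃g H)
    (p : V) : (H.neighborSet (f p)).ncard = (G.neighborSet p).ncard := by
  have h : H.neighborSet (f p) = f '' G.neighborSet p := by
    ext q
    obtain ⟨q, rfl⟩ := f.surjective q
    simp [f.map_adj_iff, f.injective.eq_iff]
  rw [h, Set.ncard_image_of_injective _ f.injective]

theorem degree_eq_ncard {V : Type*} [Fintype V] (G : SimpleGraph V) [DecidableRel G.Adj] (p : V) :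
    G.degree p = (G.neighborSet p).ncard := by
  rw [← card_neighborSet_eq_degree, ← Nat.card_eq_fintype_card, Nat.card_coe_set_eq]

/-- A graph of odd order whose edges are too many for the available colors has no edge coloring:
here all vertices but two have as many neighbors as there are colors. -/
theorem EdgeColoring.isEmpty_of_odd {W K : Type*} [Finite W] [Finite K] {G : SimpleGraph W}
    {a b : W} (hW : Odd (Nat.card W))
    (hsum : Nat.card K < (G.neighborSet a).ncard + (G.neighborSet b).ncard)
    (hreg : ∀ z, z ≠ a → z ≠ b → (G.neighborSet z).ncard = Nat.card K) :
    IsEmpty (G.EdgeColoring K) := by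
  refine ⟨fun M => ?_⟩
  have h1 := M.ncard_missing_add a
  have h2 := M.ncard_missing_add b
  -- By parity each color is missing at some vertex, and all vertices but `a` and `b` see every
  -- color.
  have h3 : {k | M.m k a = a} ∪ {k | M.m k b = b} = Set.univ := by
    rw [Set.eq_univ_iff_forall]
    intro k
    have h := M.ncard_fixed_modEq k
    have h4 : {p | M.m k p = p}.ncard ≠ 0 := by
      intro h0
      rw [h0] at h
      have := Nat.odd_iff.1 hW
      unfold Nat.ModEq at h
      omega
    obtain ⟨p, hp⟩ := Set.nonempty_of_ncard_ne_zero h4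
    have hp : M.m k p = p := hp
    by_cases ha : p = a
    · left; exact ha ▸ hp
    · by_cases hb : p = b
      · right; exact hb ▸ hp
      · exact absurd hp (M.ne_of_ncard_eq (hreg p ha hb) k)
  have h5 := Set.ncard_union_le {k | M.m k a = a} {k | M.m k b = b}
  rw [h3, Set.ncard_univ] at h5
  omega

/-- Criticality in terms of edge colorings. -/
theorem isDeltaCritical_of_edgeColoring {W : Type*} [Fintype W] {G : SimpleGraph W}
    [DecidableRel G.Adj] {Δ : ℕ} (hle : ∀ z, (G.neighborSet z).ncard ≤ Δ)
    (heq : ∃ z, (G.neighborSet z).ncard = Δ) (hpos : ∀ z, 0 < (G.neighborSet z).ncard)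
    (hG : IsEmpty (G.EdgeColoring (Fin Δ)))
    (hdel : ∀ x y, G.Adj x y → Nonempty ((G.deleteEdges {s(x, y)}).EdgeColoring (Fin Δ))) :
    G.IsDeltaCritical Δ := by
  obtain ⟨z, hz⟩ := heq
  refine ⟨le_antisymm ?_ ?_, le_antisymm ?_ ?_, ?_⟩
  · exact G.maxDegree_le_of_forall_degree_le Δ fun z => (G.degree_eq_ncard z).trans_le (hle z)
  · rw [← hz, ← degree_eq_ncard]
    exact G.degree_le_maxDegree z
  -- One edge in a color of its own, the others in `Δ` colors.
  · obtain ⟨t, ht⟩ := (Set.ncard_pos).1 (hpos z)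
    obtain ⟨M⟩ := hdel z t ht
    obtain ⟨M'⟩ := M.nonempty_option ht
    obtain ⟨C⟩ := M'.nonempty_lineGraph_coloring
    have h := C.colorable.chromaticNumber_le
    simpa [chromaticIndex] using h
  · by_contra h
    have h1 : G.lineGraph.chromaticNumber ≤ (Δ : ℕ∞) := Order.le_of_lt_add_one (not_le.1 h)
    obtain ⟨M⟩ := EdgeColoring.nonempty_of_colorable (chromaticNumber_le_iff_colorable.1 h1)
    exact hG.elim M
  · intro H hH
    -- Without isolated vertices in `G`, a subgraph with all edges has all vertices too, so a proper
    -- one lacks an edge.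
    obtain ⟨x, y, hxy, he⟩ : ∃ x y, G.Adj x y ∧ s(x, y) ∉ H.edgeSet := by
      by_contra! h
      have hadj : ∀ x y, G.Adj x y → H.Adj x y := h
      refine hH (Subgraph.ext ?_ ?_)
      · rw [Subgraph.verts_top, Set.eq_univ_iff_forall]
        intro x
        obtain ⟨y, hy⟩ := (Set.ncard_pos).1 (hpos x)
        exact H.edge_vert (hadj x y hy)
      · ext x y
        exact ⟨fun h' => H.adj_sub h', hadj x y⟩
    obtain ⟨M⟩ := hdel x y hxy
    have h := (M.colorable_coe_of_notMem H he).chromaticNumber_le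
    have h2 : (Δ : ℕ∞) < Δ + 1 := by exact_mod_cast Nat.lt_succ_self Δ
    exact h.trans_lt h2

/-! ### Degrees in the split graph, read off from the missing colors -/

section splitAt

variable {V K : Type*} {G : SimpleGraph V} {v : V} {N : Fin 2 → Set V}

theorem splitAt_adj_inr : (G.splitAt v N).Adj (Sum.inr 0) (Sum.inr 1) := by
  simp [splitAt]

theorem splitAt_not_adj_inr_one (hd : Disjoint (N 0) (N 1)) (z : {u : V // u ≠ v} ⊕ Fin 2)
    (h0 : (G.splitAt v N).Adj (Sum.inr 0) z) : ¬ (G.splitAt v N).Adj (Sum.inr 1) z := by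
  intro h1
  rcases z with p | i
  · exact Set.disjoint_left.1 hd h0 h1
  · have h0 : 0 ≠ i := h0
    have h1 : 1 ≠ i := h1
    omega

variable [Finite V] [Finite K]

theorem card_splitAt : Nat.card ({u : V // u ≠ v} ⊕ Fin 2) = Nat.card V + 1 := by
  have h : Nat.card {u : V // u ≠ v} + 1 = Nat.card V := by
    have h1 := Set.ncard_add_ncard_compl ({v} : Set V)
    rw [Set.ncard_singleton] at h1
    rw [← h1, add_comm]
    rfl
  rw [Nat.card_sum, Nat.card_eq_fintype_card (α := Fin 2), Fintype.card_fin]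
  omega

theorem ncard_neighborSet_splitAt_inl (M : G.EdgeColoring K) (hd : Disjoint (N 0) (N 1))
    (hN : N 0 ∪ N 1 = G.neighborSet v) (p : {u : V // u ≠ v}) :
    ((G.splitAt v N).neighborSet (Sum.inl p)).ncard = (G.neighborSet p.1).ncard := by
  have h1 := (M.split hd hN).ncard_missing_add (Sum.inl p)
  have h2 := M.ncard_missing_add p.1
  rw [neighborSet_deleteEdges_of_ne _ Sum.inl_ne_inr Sum.inl_ne_inr] at h1
  have h3 : {c | (M.split hd hN).m c (Sum.inl p) = Sum.inl p} = {c | M.m c p.1 = p.1} := by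
    ext c
    exact M.splitMap_inl_eq_inl
  rw [h3] at h1
  omega

/-- Each color occurs at `v`, hence at exactly one of the new vertices; the new edge contributes the
summand `2`. -/
theorem ncard_neighborSet_splitAt_inr_add (M : G.EdgeColoring K) (hd : Disjoint (N 0) (N 1))
    (hN : N 0 ∪ N 1 = G.neighborSet v) (hv : (G.neighborSet v).ncard = Nat.card K) :
    ((G.splitAt v N).neighborSet (Sum.inr 0)).ncard +
      ((G.splitAt v N).neighborSet (Sum.inr 1)).ncard = Nat.card K + 2 := by
  have h1 := (M.split hd hN).ncard_missing_add (Sum.inr 0)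
  have h2 := (M.split hd hN).ncard_missing_add (Sum.inr 1)
  have h3 := (G.splitAt v N).ncard_neighborSet_deleteEdges_left splitAt_adj_inr
  have h4 := (G.splitAt v N).ncard_neighborSet_deleteEdges_right splitAt_adj_inr
  have hm : ∀ (i : Fin 2) (c : K),
      (M.split hd hN).m c (Sum.inr i) = Sum.inr i ↔ M.m c v ∉ N i := by
    intro i c
    have hcv : M.m c v ≠ v := M.ne_of_ncard_eq hv c
    constructor
    · intro h h'
      have h5 : (M.split hd hN).m c (Sum.inr i) = Sum.inl ⟨M.m c v, hcv⟩ :=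
        M.splitMap_inr_eq_inl.2 ⟨h', rfl⟩
      rw [h] at h5
      simp at h5
    · intro h
      obtain ⟨t, ht⟩ : ∃ t, M.splitMap v N c (Sum.inr i) = t := ⟨_, rfl⟩
      rcases t with q | j
      · rw [EdgeColoring.splitMap_inr_eq_inl] at ht
        exact absurd (ht.2 ▸ ht.1) h
      · have h5 := M.splitMap_inr_eq_inr ht
        rw [← h5] at ht
        exact ht
  have h5 : {c | (M.split hd hN).m c (Sum.inr 1) = Sum.inr 1} =
      {c | (M.split hd hN).m c (Sum.inr 0) = Sum.inr 0}ᶜ := by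
    ext c
    rw [Set.mem_compl_iff, Set.mem_ofPred_eq, Set.mem_ofPred_eq, hm, hm, not_not]
    have h6 : M.m c v ∈ N 0 ∪ N 1 := by
      rw [hN]; exact M.adj_of_eq rfl (M.ne_of_ncard_eq hv c).symm
    exact ⟨fun h => h6.resolve_right h, fun h h' => Set.disjoint_left.1 hd h h'⟩
  have h6 := Set.ncard_add_ncard_compl {c | (M.split hd hN).m c (Sum.inr 0) = Sum.inr 0}
  rw [← h5] at h6
  omega

theorem two_le_ncard_neighborSet_splitAt_inr (hN : N 0 ∪ N 1 = G.neighborSet v) (i : Fin 2)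
    (hi : (N i).Nonempty) : 2 ≤ ((G.splitAt v N).neighborSet (Sum.inr i)).ncard := by
  obtain ⟨p, hp⟩ := hi
  have hpv : p ≠ v := by
    rintro rfl
    have : p ∈ N 0 ∪ N 1 := by
      fin_cases i
      · exact Or.inl hp
      · exact Or.inr hp
    rw [hN] at this
    exact G.irrefl this
  have h1 : ({Sum.inl ⟨p, hpv⟩, Sum.inr (i + 1)} : Set ({u : V // u ≠ v} ⊕ Fin 2)) ⊆
      (G.splitAt v N).neighborSet (Sum.inr i) := by
    rintro z (rfl | rfl)
    · exact hp
    · show i ≠ i + 1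
      omega
  exact (Set.ncard_pair Sum.inl_ne_inr).symm.trans_le (Set.ncard_le_ncard h1)

end splitAt

end SimpleGraph

/-! ### The theorem -/

open SimpleGraph in
theorem theorem1p1 (n Δ : ℕ) (hn : 0 < n) (hΔ : 0 < Δ) (h : 3 * ((n : ℝ) - 1) / 4 ≤ (Δ : ℝ))
    {V W : Type*} [Fintype V] [Fintype W]
    (G₀ : SimpleGraph V) [DecidableRel G₀.Adj] (G : SimpleGraph W) [DecidableRel G.Adj]
    (hcard : Fintype.card V = n - 1) (hreg : G₀.IsRegularOfDegree Δ) (hclass : G₀.IsClassOne)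
    (hsplit : G₀.IsVertexSplitting G) :
    G.IsDeltaCritical Δ := by
  obtain ⟨v, N, hN0, hN1, hd, hN, ⟨f⟩⟩ := hsplit
  have : Nonempty V := ⟨v⟩
  have hcol : G₀.lineGraph.Colorable Δ := by
    rw [← chromaticNumber_le_iff_colorable]
    unfold SimpleGraph.IsClassOne chromaticIndex at hclass
    rw [hclass, hreg.maxDegree_eq]
  obtain ⟨M₀⟩ := EdgeColoring.nonempty_of_colorable hcol
  have hdeg : ∀ p, (G₀.neighborSet p).ncard = Nat.card (Fin Δ) := fun p => by
    rw [← degree_eq_ncard, hreg.degree_eq, Nat.card_eq_fintype_card, Fintype.card_fin]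
  have hV : Nat.card V = n - 1 := by rw [Nat.card_eq_fintype_card, hcard]
  have hVpos : 0 < Nat.card V := Nat.card_pos
  set H := G₀.splitAt v N with hH
  have hcardW : Nat.card ({u : V // u ≠ v} ⊕ Fin 2) = n := by
    rw [card_splitAt]; omega
  have hW : Odd (Nat.card ({u : V // u ≠ v} ⊕ Fin 2)) := by
    -- As `0 < Δ`, there is a color; its class is a perfect matching of `G₀`, so `V` has even order.
    have h1 := M₀.ncard_fixed_modEq ⟨0, hΔ⟩
    have h2 : {p | M₀.m ⟨0, hΔ⟩ p = p} = ∅ := by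
      rw [Set.eq_empty_iff_forall_notMem]
      exact fun p => M₀.ne_of_ncard_eq (hdeg p) _
    rw [h2, Set.ncard_empty] at h1
    unfold Nat.ModEq at h1
    rw [card_splitAt, Nat.odd_iff]
    omega
  have hK : Nat.card (Fin Δ) = Δ := by rw [Nat.card_eq_fintype_card, Fintype.card_fin]
  have hbound : 3 * Nat.card ({u : V // u ≠ v} ⊕ Fin 2) ≤ 4 * Nat.card (Fin Δ) + 3 := by
    rw [hcardW, hK]
    have h1 : (3 * n : ℝ) ≤ 4 * Δ + 3 := by linarith
    exact_mod_cast h1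
  have hsum := ncard_neighborSet_splitAt_inr_add M₀ hd hN (hdeg v)
  have ha := two_le_ncard_neighborSet_splitAt_inr hN 0 hN0
  have hb := two_le_ncard_neighborSet_splitAt_inr hN 1 hN1
  have hinl := fun p => (ncard_neighborSet_splitAt_inl M₀ hd hN p).trans (hdeg p)
  have hreg' : ∀ z, z ≠ Sum.inr 0 → z ≠ Sum.inr 1 →
      (H.neighborSet z).ncard = Nat.card (Fin Δ) := by
    rintro (p | i) h0 h1
    · exact hinl p
    · fin_cases i
      · exact absurd rfl h0
      · exact absurd rfl h1
  rw [← hH] at hsum ha hb hinl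
  have hdegree : ∀ z, (H.neighborSet z).ncard ≤ Δ ∧ 0 < (H.neighborSet z).ncard := by
    intro z
    by_cases h0 : z = Sum.inr 0
    · subst h0; omega
    · by_cases h1 : z = Sum.inr 1
      · subst h1; omega
      · rw [hreg' z h0 h1, hK]; omega
  have hG : ∀ z, (G.neighborSet z).ncard = (H.neighborSet (f z)).ncard := fun z =>
    (f.ncard_neighborSet z).symm
  refine isDeltaCritical_of_edgeColoring (fun z => hG z ▸ (hdegree (f z)).1) ?_
    (fun z => hG z ▸ (hdegree (f z)).2) ?_ ?_
  · obtain ⟨p, hp⟩ := hN0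
    have hpv : p ≠ v := by
      rintro rfl
      have : p ∈ N 0 ∪ N 1 := Or.inl hp
      rw [hN] at this
      exact G₀.irrefl this
    refine ⟨f.symm (Sum.inl ⟨p, hpv⟩), ?_⟩
    rw [hG, RelIso.apply_symm_apply, hinl, hK]
  · have hE : IsEmpty (H.EdgeColoring (Fin Δ)) :=
      EdgeColoring.isEmpty_of_odd hW (by omega) hreg'
    exact ⟨fun M => hE.elim (M.congr f)⟩
  · intro x y hxy
    obtain ⟨M⟩ := (M₀.split hd hN).nonempty_deleteEdges_of_degree_sum hW hbound splitAt_adj_inr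
      (splitAt_not_adj_inr_one hd) hsum ha hb hreg' (f.map_adj_iff.2 hxy)
    exact ⟨M.congr (f.deleteEdge x y).symm⟩
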